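/- **Model.** Base stations (BSs) form a homogeneous Poisson point process $\Phi$ of density $\lambda>0$ on $\mathbb R^2$; mobile users (MUs) form an independent homogeneous Poisson point process of density $\mu>0$, together with a typical MU $\mathsf m$ at the origin. Each MU $u$ is connected to its nearest BS $\mathsf n(u)$, at distance $d_u$, and each BS serves the MUs connected to it in a round-robin fashion over time slots (a BS without MUs is silent). The path-loss function is $\ell(d)=\min\{1,d^{-\alpha}\}$ with $\alpha>2$. The fading gain $h_z(t)$ from BS $z$ to $\mathsf m$ in slot $t$ is exponential with parameter $1$, independent over all $z$ and $t$ and independent of locations and schedule. Let $0<\gamma\le 1$ (interference suppression parameter), $\mathsf N>0$ (noise variance), $\beta>0$ (SINR threshold) and $M>0$ (average power constraint). If $\mathbf 1_z(t)$ indicates that BS $z$ transmits in slot $t$ and $P_z(t)$ is its transmit power, then, with $d_0=|\mathsf n(\mathsf m)|$ the distance from $\mathsf m$ to its BS, $$\mathsf{SINR}(t)=\frac{P_{\mathsf n(\mathsf m)}(t)\,h_{\mathsf n(\mathsf m)}(t)\,\ell(d_0)\,\mathbf 1_{\mathsf n(\mathsf m)}(t)}{\gamma\sum_{z\in\Phi\setminus\{\mathsf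 n(\mathsf m)\}}P_z(t)\,\mathbf 1_z(t)\,h_z(t)\,\ell(|z|)+\mathsf N}.$$ The delay $D$ is the least $t\ge1$ such that $\mathsf{SINR}>\beta$ in the $t$-th slot dedicated to $\mathsf m$, and the network-wide capacity of a strategy $\mathcal S$ is $C(\mathcal S)=\lambda/\mathbb E[D]$. **Strategy.** Let $0<\varepsilon<1$ with $\beta\gamma(1-\varepsilon)<1$ and $c=M/(1-\varepsilon)$. In a slot designated for an MU $u$, the BS $\mathsf n(u)$ transmits with probability $M/(c\,\ell(d_u)^{-1})$ and, if it transmits, uses power $c\,\ell(d_u)^{-1}$; given locations and schedule, the transmission decisions are independent over BSs and slots and independent of the fading gains. **Theorem.** There are constants $c_4,c_5,c_6,c_7>0$, depending only on $\alpha,\beta,\gamma,\mathsf N,M,\varepsilon$, such that for all $\lambda,\mu>0$ this strategy $\mathcal S$ satisfies $$\mathbb E[D]\le\sqrt{c_5\left(1+\frac{\Gamma(\alpha+1)}{(\pi\lambda)^{\alpha}}\right)\exp(c_4\lambda)}$$ and $$C(\mathcal S)\ge\min\left\{\frac{\lambda^{\alpha/2+1}}{c_6},\;c_7\,\lambda\exp(-c_4\lambda)\right\}.$$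 -/

import Mathlib

open MeasureTheory ProbabilityTheory
open scoped ENNReal NNReal

noncomputable section

namespace Cellular

/-- The plane `ℝ²` with its Euclidean distance and Lebesgue measure. -/
abbrev Plane : Type := EuclideanSpace ℝ (Fin 2)

/-! ### Poisson point processes -/

/-- The number (possibly infinite) of points of the enumerated configuration `x` lying in `A`. -/
def pointCount (x : ℕ → Plane) (A : Set Plane) : ℕ∞ := {n | x n ∈ A}.encard

/-- The random points `X 0, X 1, …` enumerate a homogeneous Poisson point process of density `lam`
on the plane: the number of points in a Borel set of finite area is Poisson distributed with mean
`lam * area`, and the numbers of points in disjoint Borel sets are independent. (For `lam > 0` such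
a process almost surely has infinitely many points, so it can be enumerated by `ℕ`.) -/
structure IsPoissonPointProcess {Ω : Type*} [MeasurableSpace Ω] (P : Measure Ω) (lam : ℝ)
    (X : Ω → ℕ → Plane) : Prop where
  measurable : Measurable X
  law : ∀ A : Set Plane, MeasurableSet A → volume A ≠ ∞ →
    HasLaw (fun ω => pointCount (X ω) A)
      ((poissonMeasure (lam.toNNReal * (volume A).toNNReal)).map (Nat.cast : ℕ → ℕ∞)) P
  indep : ∀ (k : ℕ) (A : Fin k → Set Plane), (∀ i, MeasurableSet (A i)) →
    Pairwise (fun i j => Disjoint (A i) (A j)) →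
    iIndepFun (fun i ω => pointCount (X ω) (A i)) P

/-! ### Path loss and transmission strategies -/

/-- The path-loss function `min {1, d ^ (-α)}` (with value `1` at `d = 0`), written so that no
negative power of `0` occurs. -/
def pathLoss (α d : ℝ) : ℝ := (max 1 d) ^ (-α)

theorem pathLoss_eq_min {α d : ℝ} (hα : 0 < α) (hd : 0 < d) :
    pathLoss α d = min 1 (d ^ (-α)) := by
  unfold pathLoss
  rcases le_total d 1 with h | h
  · rw [max_eq_left h, Real.one_rpow, min_eq_left]
    exact Real.one_le_rpow_of_pos_of_le_one_of_nonpos hd h (by linarith)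
  · rw [max_eq_right h, min_eq_right]
    exact Real.rpow_le_one_of_one_le_of_nonpos h (by linarith)

/-- A non-adaptive strategy depending only on the distance `d` between a base station and the user
it serves in a slot: the base station transmits with probability `prob d`, and if it transmits it
uses power `power d`. -/
structure DistanceStrategy where
  prob : ℝ → ℝ
  power : ℝ → ℝ

/-- Transmit power `c * ℓ(d)⁻¹` with probability `M / (c * ℓ(d)⁻¹)`. -/
def powerControl (α M c : ℝ) : DistanceStrategy where
  prob d := M / (c * (pathLoss α d)⁻¹)
  power d := c * (pathLoss α d)⁻¹

/-! ### A realization of the network -/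

/-- One realization of all the randomness in the network. -/
structure Realization where
  /-- Location of the `n`-th base station. -/
  bs : ℕ → Plane
  /-- Locations of the mobile users other than the typical one. -/
  otherUser : ℕ → Plane
  /-- `sched n s` is the user to which base station `n` assigns time slot `s`. -/
  sched : ℕ → ℕ → ℕ
  /-- `fading n s` is the fading gain from base station `n` to the typical user in slot `s`. -/
  fading : ℕ → ℕ → ℝ
  /-- `coin n s` decides whether base station `n` transmits in slot `s`: it does so with
  probability `p` by transmitting when the uniform variable `coin n s` is less than `p`. -/
  coin : ℕ → ℕ → ℝ

namespace Realization

variable (w : Realization)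

/-- Locations of all the mobile users; user `0` is the typical one, at the origin. -/
def user : ℕ → Plane
  | 0 => 0
  | j + 1 => w.otherUser j

/-- The (index of the) base station nearest to the point `y`. -/
def nearestBS (y : Plane) : ℕ := sInf {n | ∀ m, dist (w.bs n) y ≤ dist (w.bs m) y}

/-- The base station serving the typical user. -/
def servingBS : ℕ := w.nearestBS 0

/-- The distance from user `j` to its nearest base station. -/
def userDist (j : ℕ) : ℝ := dist (w.bs (w.nearestBS (w.user j))) (w.user j)

/-- The users connected to base station `n`, that is, those lying in its Voronoi cell. -/
def cell (n : ℕ) : Set ℕ := {j | w.nearestBS (w.user j) = n}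

/-- Each base station whose cell holds at least one user serves the users of its cell in
round-robin: every user of the cell is served again and again, and the order of service is periodic
with period the number of users in the cell (hence each of them is served exactly once in each
period). The period condition is vacuous for an infinite cell, an event of probability zero. -/
def IsRoundRobin : Prop :=
  ∀ n, (w.cell n).Nonempty →
    (∀ s, w.sched n s ∈ w.cell n) ∧
    (∀ j ∈ w.cell n, ∀ s, ∃ s', s ≤ s' ∧ w.sched n s' = j) ∧
    (∀ s, w.sched n (s + (w.cell n).ncard) = w.sched n s)

/-- Base station `n` transmits in slot `s` under strategy `S`. A base station without users in its
cell stays silent. -/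
def Transmits (S : DistanceStrategy) (n s : ℕ) : Prop :=
  w.sched n s ∈ w.cell n ∧ w.coin n s < S.prob (w.userDist (w.sched n s))

open Classical in
/-- The power received at the typical user (at the origin) from base station `n` in slot `s`. -/
def receivedPower (α : ℝ) (S : DistanceStrategy) (n s : ℕ) : ℝ≥0∞ :=
  if w.Transmits S n s then
    ENNReal.ofReal (S.power (w.userDist (w.sched n s)) * w.fading n s * pathLoss α ‖w.bs n‖)
  else 0

/-- The interference at the typical user in slot `s`: the total power received from all base
stations other than the serving one. -/
def interference (α : ℝ) (S : DistanceStrategy) (s : ℕ) : ℝ≥0∞ :=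
  ∑' n : {n : ℕ // n ≠ w.servingBS}, w.receivedPower α S n s

/-- The signal-to-interference-plus-noise ratio at the typical user in slot `s`, with interference
suppression parameter `γ` and noise variance `N`. -/
def sinr (α γ N : ℝ) (S : DistanceStrategy) (s : ℕ) : ℝ≥0∞ :=
  w.receivedPower α S w.servingBS s /
    (ENNReal.ofReal γ * w.interference α S s + ENNReal.ofReal N)

/-- The `t`-th slot (`t = 0, 1, …`) that the serving base station dedicates to the typical user. -/
def dedicatedSlot (t : ℕ) : ℕ := Nat.nth (fun s => w.sched w.servingBS s = 0) t

/-- The delay of a packet: the least `t ≥ 1` such that the transmission in the `t`-th slot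
dedicated to the typical user is successful (infinite if there is none). -/
def delay (α β γ N : ℝ) (S : DistanceStrategy) : ℕ∞ :=
  ⨅ t ∈ {t : ℕ | 0 < t ∧ ENNReal.ofReal β < w.sinr α γ N S (w.dedicatedSlot (t - 1))}, (t : ℕ∞)

end Realization

/-! ### The random network -/

/-- The random cellular network: base stations and users form independent Poisson point processes
of densities `lam` and `mu`; each base station serves its users in round-robin; the fading gains
are exponential with parameter `1`, the coins are uniform on `[0, 1]`, all of them are independent
over base stations and slots, and jointly independent of locations and schedule. -/
structure IsCellularNetwork {Ω : Type*} [MeasurableSpace Ω] (P : Measure Ω) (lam mu : ℝ)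
    (W : Ω → Realization) : Prop where
  bs_poisson : IsPoissonPointProcess P lam (fun ω => (W ω).bs)
  user_poisson : IsPoissonPointProcess P mu (fun ω => (W ω).otherUser)
  bs_indep_user : IndepFun (fun ω => (W ω).bs) (fun ω => (W ω).otherUser) P
  sched_measurable : Measurable (fun ω => (W ω).sched)
  roundRobin : ∀ᵐ ω ∂P, (W ω).IsRoundRobin
  fading_measurable : Measurable (fun ω => (W ω).fading)
  coin_measurable : Measurable (fun ω => (W ω).coin)
  fading_law : ∀ n s, HasLaw (fun ω => (W ω).fading n s) (expMeasure 1) P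
  coin_law : ∀ n s, HasLaw (fun ω => (W ω).coin n s) (volume.restrict (Set.Icc (0 : ℝ) 1)) P
  fading_indep_coin : ∀ n s, IndepFun (fun ω => (W ω).fading n s) (fun ω => (W ω).coin n s) P
  marks_indep : iIndepFun
    (fun (i : ℕ × ℕ) ω => ((W ω).fading i.1 i.2, (W ω).coin i.1 i.2)) P
  geometry_indep_marks : IndepFun
    (fun ω => ((W ω).bs, (W ω).otherUser, (W ω).sched))
    (fun ω => ((W ω).fading, (W ω).coin)) P

/-- The expected delay `E[D]` of the strategy `S`, in `[0, ∞]`. -/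
def expectedDelay {Ω : Type*} [MeasurableSpace Ω] (P : Measure Ω) (W : Ω → Realization)
    (α β γ N : ℝ) (S : DistanceStrategy) : ℝ≥0∞ :=
  ∫⁻ ω, (((W ω).delay α β γ N S : ℕ∞) : ℝ≥0∞) ∂P

/-- The network-wide capacity `lam / E[D]` of the strategy `S`. -/
def capacity {Ω : Type*} [MeasurableSpace Ω] (P : Measure Ω) (W : Ω → Realization)
    (lam α β γ N : ℝ) (S : DistanceStrategy) : ℝ≥0∞ :=
  ENNReal.ofReal lam / expectedDelay P W α β γ N S

end Cellular

end

/-! Fix the locations and the schedule. Power control inverts the path loss of the served link, so a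
transmission reaches the typical user with power `c h`, while the mean power of every station is at
most `M` whomever it serves; this removes the schedule and the user density from all bounds. An
exponential gain exceeds an independent threshold `Y + b`, `b ≥ 0`, with probability `exp (-b) E[exp
(-Y)]`. Here `Y` is a sum of independent interference terms, and `exp (-x) ≥ 1 - x` bounds each
factor below by `1 - κ ℓ(|z|)`, where `κ = β' γ (1 - ε) < 1` for some `β'` slightly above `β`. This
bounds the success probability of a slot below by some `p` (`le_measure_lt_sinr`). Marks of
different slots are independent, so the delay has tails at most `(1 - p) ^ t` and conditional mean
at most `1 / p`, a constant times `ℓ(d₀)⁻¹ ∏ (1 - κ ℓ(|z|))⁻¹` with the `|z|` rounded down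
(`lintegral_delay_withMarks_le`).

Both random factors depend on the base stations, so Cauchy–Schwarz separates them
(`expectedDelay_le`). The second moment of `ℓ(d₀)⁻¹` follows from void probabilities
(`lintegral_userDist_rpow_le`), that of the product from the generating functions of independent
Poisson counts in annuli (`lintegral_interferenceFactor_sq_le`); the resulting exponent is finite
because `α > 2` (`exists_sum_annulus_le`). The capacity bound follows by separating `λ ≤ 1` from `λ
≥ 1`. -/

noncomputable section

namespace Cellular

/-! ### Measurability of integer-valued selections; first success times. -/

section Countable

variable {Ω : Type*} [MeasurableSpace Ω]

theorem measurable_nat_sInf {S : Ω → Set ℕ} (hS : ∀ n, MeasurableSet {ω | n ∈ S ω}) :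
    Measurable fun ω => sInf (S ω) := by
  refine measurable_of_Iic fun k => ?_
  -- The last intersection is the event `S ω = ∅`, where `sInf` takes its default value `0 ≤ k`.
  have : (fun ω => sInf (S ω)) ⁻¹' Set.Iic k =
      (⋃ n ∈ Set.Iic k, {ω | n ∈ S ω}) ∪ ⋂ n, {ω | n ∈ S ω}ᶜ := by
    ext ω
    simp only [Set.mem_preimage, Set.mem_Iic, Set.mem_union, Set.mem_iUnion, Set.mem_ofPred_eq,
      Set.mem_iInter, Set.mem_compl_iff, exists_prop]
    constructor
    · intro h
      rcases (S ω).eq_empty_or_nonempty with h' | h'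
      · right; simp [h']
      · exact Or.inl ⟨_, h, Nat.sInf_mem h'⟩
    · rintro (⟨n, hn, h⟩ | h)
      · exact (Nat.sInf_le h).trans hn
      · have : S ω = ∅ := Set.eq_empty_of_forall_notMem h
        simp [this]
  rw [this]
  exact (MeasurableSet.biUnion (Set.to_countable _) fun n _ => hS n).union
    (MeasurableSet.iInter fun n => (hS n).compl)

theorem measurable_comp_countable {ι E : Type*} [MeasurableSpace ι] [Countable ι]
    [MeasurableSingletonClass ι] [MeasurableSpace E] {f : ι → Ω → E} {k : Ω → ι}
    (hf : ∀ i, Measurable (f i)) (hk : Measurable k) : Measurable fun ω => f (k ω) ω :=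
  (measurable_from_prod_countable_right (f := fun q : ι × Ω => f q.1 q.2) hf).comp
    (hk.prodMk measurable_id)

theorem measurable_nat_nth {p : Ω → ℕ → Prop} (hp : ∀ n, MeasurableSet {ω | p ω n}) (t : ℕ) :
    Measurable fun ω => Nat.nth (p ω) t := by
  classical
  have hcount : ∀ n, Measurable fun ω => Nat.count (p ω) n := by
    intro n
    induction n with
    | zero => simp
    | succ n ih =>
      simp only [Nat.count_succ]
      exact ih.add (Measurable.ite (hp n) measurable_const measurable_const)
  have hset : ∀ k, MeasurableSet {ω | p ω k ∧ Nat.count (p ω) k = t} := fun k =>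
    (hp k).inter (hcount k (measurableSet_singleton t))
  -- `Nat.nth` defaults to `0` when there are too few indices, so only nonzero values identify a
  -- genuine `t`-th index; the fibre over `0` is recovered below as a complement.
  have key : ∀ ω k, k ≠ 0 → (Nat.nth (p ω) t = k ↔ p ω k ∧ Nat.count (p ω) k = t) := by
    intro ω k hk
    constructor
    · rintro rfl
      have h : ∀ hf : (Set.ofPred (p ω)).Finite, t < hf.toFinset.card := by
        intro hf
        by_contra! h
        exact hk (Nat.nth_of_card_le hf h)
      exact ⟨Nat.nth_mem t h, Nat.count_nth h⟩
    · rintro ⟨h, rfl⟩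
      exact Nat.nth_count h
  have hne : ∀ k, k ≠ 0 → MeasurableSet ((fun ω => Nat.nth (p ω) t) ⁻¹' {k}) := by
    intro k hk
    convert! hset k using 1
    ext ω
    exact key ω k hk
  refine measurable_to_countable' fun k => ?_
  by_cases hk : k = 0
  · subst hk
    have : (fun ω => Nat.nth (p ω) t) ⁻¹' {0} =
        (⋃ k ∈ {k : ℕ | k ≠ 0}, (fun ω => Nat.nth (p ω) t) ⁻¹' {k})ᶜ := by
      ext ω
      simp only [Set.mem_preimage, Set.mem_singleton_iff, Set.mem_compl_iff, Set.mem_iUnion,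
        Set.mem_ofPred_eq, exists_prop]
      grind
    rw [this]
    exact (MeasurableSet.biUnion (Set.to_countable _) fun k hk => hne k hk).compl
  · exact hne k hk

/-- The first success time, as the number of initial runs of failures. -/
theorem toENNReal_iInf_succ_eq_tsum (p : ℕ → Prop) [∀ t : ℕ, Decidable (∀ i < t, ¬ p i)] :
    ((⨅ t ∈ {t : ℕ | 0 < t ∧ p (t - 1)}, (t : ℕ∞) : ℕ∞) : ℝ≥0∞) =
      ∑' t : ℕ, if ∀ i < t, ¬ p i then 1 else 0 := by
  classical
  by_cases h : ∃ n, p n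
  · have hd : (⨅ t ∈ {t : ℕ | 0 < t ∧ p (t - 1)}, (t : ℕ∞) : ℕ∞) = ((Nat.find h + 1 : ℕ) : ℕ∞) := by
      apply le_antisymm
      · exact iInf₂_le (Nat.find h + 1) ⟨Nat.succ_pos _, by simpa using Nat.find_spec h⟩
      · refine le_iInf₂ fun t ht => ?_
        have := Nat.find_min' h ht.2
        have h0 := ht.1
        exact_mod_cast (by omega : Nat.find h + 1 ≤ t)
    rw [hd, tsum_eq_sum (s := Finset.range (Nat.find h + 1))]
    · rw [Finset.sum_congr rfl (g := fun _ => (1 : ℝ≥0∞))]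
      · simp
      · intro t ht
        rw [if_pos]
        intro i hi
        rw [Finset.mem_range] at ht
        exact Nat.find_min h (by omega)
    · intro t ht
      rw [Finset.mem_range] at ht
      rw [if_neg]
      intro hc
      exact hc _ (by omega) (Nat.find_spec h)
  · push Not at h
    have h1 : (⨅ t ∈ {t : ℕ | 0 < t ∧ p (t - 1)}, (t : ℕ∞) : ℕ∞) = ⊤ := by simp [h]
    have h2 : ∀ t : ℕ, (if ∀ i < t, ¬ p i then (1 : ℝ≥0∞) else 0) = 1 :=
      fun t => if_pos fun i _ => h i
    rw [h1, tsum_congr h2, ENNReal.tsum_const_eq_top_of_ne_zero one_ne_zero]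
    simp

end Countable

/-! ### Measurability of the network quantities. -/

theorem measurable_pathLoss (α : ℝ) : Measurable (pathLoss α) := by
  unfold pathLoss
  fun_prop

namespace Realization

/-- All the components of the random realization `W` are measurable. -/
structure MeasurableFamily {Ω : Type*} [MeasurableSpace Ω] (W : Ω → Realization) : Prop where
  bs : Measurable fun ω => (W ω).bs
  otherUser : Measurable fun ω => (W ω).otherUser
  sched : Measurable fun ω => (W ω).sched
  fading : Measurable fun ω => (W ω).fading
  coin : Measurable fun ω => (W ω).coin

namespace MeasurableFamily

variable {Ω : Type*} [MeasurableSpace Ω] {W : Ω → Realization} (hW : MeasurableFamily W)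
include hW

theorem bs_apply (n : ℕ) : Measurable fun ω => (W ω).bs n := (measurable_pi_iff.1 hW.bs) n

theorem sched_apply (n s : ℕ) : Measurable fun ω => (W ω).sched n s :=
  measurable_pi_iff.1 (measurable_pi_iff.1 hW.sched n) s

theorem user (j : ℕ) : Measurable fun ω => (W ω).user j := by
  cases j with
  | zero => exact measurable_const
  | succ j => exact measurable_pi_iff.1 hW.otherUser j

theorem nearestBS {y : Ω → Plane} (hy : Measurable y) :
    Measurable fun ω => (W ω).nearestBS (y ω) := by
  refine measurable_nat_sInf fun n => ?_
  simp only [Set.mem_ofPred_eq]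
  rw [Set.ofPred_forall]
  exact MeasurableSet.iInter fun m =>
    measurableSet_le ((hW.bs_apply n).dist hy) ((hW.bs_apply m).dist hy)

theorem servingBS : Measurable fun ω => (W ω).servingBS := hW.nearestBS measurable_const

theorem userDist (j : ℕ) : Measurable fun ω => (W ω).userDist j :=
  (measurable_comp_countable hW.bs_apply (hW.nearestBS (hW.user j))).dist (hW.user j)

theorem userDist_sched (n s : ℕ) :
    Measurable fun ω => (W ω).userDist ((W ω).sched n s) :=
  measurable_comp_countable hW.userDist (hW.sched_apply n s)

theorem measurableSet_transmits {S : DistanceStrategy} (hS : Measurable S.prob) (n s : ℕ) :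
    MeasurableSet {ω | (W ω).Transmits S n s} := by
  have h1 : Measurable fun ω => (W ω).nearestBS ((W ω).user ((W ω).sched n s)) :=
    measurable_comp_countable (f := fun j ω => (W ω).nearestBS ((W ω).user j))
      (fun j => hW.nearestBS (hW.user j)) (hW.sched_apply n s)
  exact (h1 (measurableSet_singleton n)).inter
    (measurableSet_lt (measurable_pi_iff.1 (measurable_pi_iff.1 hW.coin n) s)
      (hS.comp (hW.userDist_sched n s)))

theorem receivedPower (α : ℝ) {S : DistanceStrategy} (hS : Measurable S.prob)
    (hS' : Measurable S.power) (n s : ℕ) :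
    Measurable fun ω => (W ω).receivedPower α S n s := by
  classical
  unfold Realization.receivedPower
  refine Measurable.ite (hW.measurableSet_transmits hS n s) ?_ measurable_const
  exact (((hS'.comp (hW.userDist_sched n s)).mul
    (measurable_pi_iff.1 (measurable_pi_iff.1 hW.fading n) s)).mul
    ((measurable_pathLoss α).comp (hW.bs_apply n).norm)).ennreal_ofReal

-- The original index type depends on the realization; summing over all of `ℕ` with a zero term
-- makes measurability accessible.
omit hW in
theorem _root_.Cellular.Realization.interference_eq_tsum (w : Realization) (α : ℝ)
    (S : DistanceStrategy) (s : ℕ) :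
    w.interference α S s = ∑' n, if n = w.servingBS then 0 else w.receivedPower α S n s := by
  have := tsum_subtype {n : ℕ | n ≠ w.servingBS} fun n => w.receivedPower α S n s
  refine this.trans (tsum_congr fun n => ?_)
  by_cases h : n = w.servingBS <;> simp [h, Set.indicator]

theorem sinr (α γ N : ℝ) {S : DistanceStrategy} (hS : Measurable S.prob)
    (hS' : Measurable S.power) (s : ℕ) : Measurable fun ω => (W ω).sinr α γ N S s := by
  unfold Realization.sinr
  simp only [interference_eq_tsum]
  have h1 : Measurable fun ω => (W ω).receivedPower α S (W ω).servingBS s :=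
    measurable_comp_countable (fun n => hW.receivedPower α hS hS' n s) hW.servingBS
  refine h1.div ((Measurable.const_mul ?_ _).add_const _)
  refine Measurable.tsum fun n => ?_
  have hn : MeasurableSet {ω | n = (W ω).servingBS} := by
    simpa only [Set.preimage, Set.mem_singleton_iff, eq_comm] using
      hW.servingBS (measurableSet_singleton n)
  exact Measurable.ite hn measurable_const (hW.receivedPower α hS hS' n s)

theorem dedicatedSlot (t : ℕ) : Measurable fun ω => (W ω).dedicatedSlot t := by
  refine measurable_nat_nth (fun s => ?_) t
  exact (measurable_comp_countable (f := fun n ω => (W ω).sched n s)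
    (fun n => hW.sched_apply n s) hW.servingBS) (measurableSet_singleton 0)

open Classical in
omit hW in
theorem _root_.Cellular.Realization.toENNReal_delay (w : Realization) (α β γ N : ℝ)
    (S : DistanceStrategy) :
    ((w.delay α β γ N S : ℕ∞) : ℝ≥0∞) =
      ∑' t : ℕ, if ∀ i < t, ¬ ENNReal.ofReal β < w.sinr α γ N S (w.dedicatedSlot i)
        then 1 else 0 :=
  toENNReal_iInf_succ_eq_tsum fun i => ENNReal.ofReal β < w.sinr α γ N S (w.dedicatedSlot i)

/-- Needed to integrate the delay first over the marks and then over the geometry. -/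
theorem delay (α β γ N : ℝ) {S : DistanceStrategy} (hS : Measurable S.prob)
    (hS' : Measurable S.power) :
    Measurable fun ω => (((W ω).delay α β γ N S : ℕ∞) : ℝ≥0∞) := by
  simp only [toENNReal_delay]
  refine Measurable.tsum fun t => Measurable.ite ?_ measurable_const measurable_const
  simp only [Set.ofPred_forall]
  refine MeasurableSet.iInter fun i => MeasurableSet.iInter fun _ => ?_
  exact (measurableSet_lt measurable_const (measurable_comp_countable
    (fun s => hW.sinr α γ N hS hS' s) (hW.dedicatedSlot i))).compl

end MeasurableFamily

end Realization

theorem measurable_powerControl_prob (α M c : ℝ) : Measurable (powerControl α M c).prob :=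
  (measurable_const.div (measurable_const.mul (measurable_pathLoss α).inv))

theorem measurable_powerControl_power (α M c : ℝ) : Measurable (powerControl α M c).power :=
  measurable_const.mul (measurable_pathLoss α).inv

/-! ### Exponential gains, thinning, and success in one slot. -/

section Probability

variable {Ω : Type*} [MeasurableSpace Ω] {P : Measure Ω}

theorem expMeasure_one_Ioi {x : ℝ} (hx : 0 ≤ x) :
    expMeasure 1 (Set.Ioi x) = ENNReal.ofReal (Real.exp (-x)) := by
  have := isProbabilityMeasure_expMeasure one_pos
  have h := cdf_expMeasure_eq one_pos x
  rw [if_pos hx, cdf_eq_real, one_mul] at h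
  have h2 := prob_compl_eq_one_sub (μ := expMeasure 1) (measurableSet_Iic (a := x))
  rw [Set.compl_Iic] at h2
  rw [h2, ← ENNReal.ofReal_toReal (measure_ne_top (expMeasure 1) (Set.Iic x)), ← measureReal_def,
    h, ← ENNReal.ofReal_one, ← ENNReal.ofReal_sub _ (by simpa using hx)]
  congr 1
  ring

theorem lintegral_ofReal_expMeasure_one : ∫⁻ x, ENNReal.ofReal x ∂(expMeasure 1) = 1 := by
  have h := lintegral_eq_lintegral_meas_lt (expMeasure 1) (f := fun x : ℝ => max x 0)
    (Filter.Eventually.of_forall fun x => le_max_right _ _) (by fun_prop)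
  have h1 : ∀ x : ℝ, ENNReal.ofReal (max x 0) = ENNReal.ofReal x := by
    intro x
    rcases le_total x 0 with hx | hx
    · simp [hx]
    · simp [hx]
  simp only [h1] at h
  rw [h, setLIntegral_congr_fun (g := fun t => ENNReal.ofReal (Real.exp (-t))) measurableSet_Ioi]
  · rw [← ofReal_integral_eq_lintegral_ofReal (integrableOn_exp_neg_Ioi 0)
      (Filter.Eventually.of_forall fun t => (Real.exp_pos _).le), integral_exp_neg_Ioi_zero]
    simp
  · intro t ht
    simp only
    rw [← expMeasure_one_Ioi (le_of_lt ht)]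
    congr 1
    ext x
    have ht' : ¬ t < 0 := not_lt.2 (le_of_lt ht)
    simp [ht']

theorem measure_coin_lt {U : Ω → ℝ} (hU : HasLaw U (volume.restrict (Set.Icc (0 : ℝ) 1)) P)
    {q : ℝ} (h1 : q ≤ 1) : P {ω | U ω < q} = ENNReal.ofReal q := by
  rw [hU.measure_eq (p := fun x => x < q) measurableSet_Iio]
  refine (Measure.restrict_apply measurableSet_Iio).trans ?_
  have : {x : ℝ | x < q} ∩ Set.Icc 0 1 = Set.Ico 0 q := by
    ext x
    simp only [Set.mem_inter_iff, Set.mem_ofPred_eq, Set.mem_Icc, Set.mem_Ico]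
    constructor
    · rintro ⟨a, b, c⟩; exact ⟨b, a⟩
    · rintro ⟨a, b⟩; exact ⟨b, a, by linarith⟩
  exact (congrArg volume this).trans (by simp)

theorem lintegral_thinned_exp {H U : Ω → ℝ} (hHm : Measurable H) (hUm : Measurable U)
    (hH : HasLaw H (expMeasure 1) P)
    (hU : HasLaw U (volume.restrict (Set.Icc (0 : ℝ) 1)) P) (hHU : IndepFun H U P)
    {q k : ℝ} (hq : q ≤ 1) (hk : 0 ≤ k) :
    ∫⁻ ω, {ω | U ω < q}.indicator (fun ω => ENNReal.ofReal (k * H ω)) ω ∂P =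
      ENNReal.ofReal q * ENNReal.ofReal k := by
  have hind : IndepFun (fun ω => ENNReal.ofReal (k * H ω))
      (fun ω => (Set.Iio q).indicator (1 : ℝ → ℝ≥0∞) (U ω)) P :=
    hHU.comp (φ := fun x => ENNReal.ofReal (k * x)) (ψ := (Set.Iio q).indicator (1 : ℝ → ℝ≥0∞))
      (by fun_prop) (measurable_one.indicator measurableSet_Iio)
  have hm : Measurable fun ω => (Set.Iio q).indicator (1 : ℝ → ℝ≥0∞) (U ω) :=
    (measurable_one.indicator measurableSet_Iio).comp hUm
  have h := lintegral_mul_eq_lintegral_mul_lintegral_of_indepFun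
    (by fun_prop : Measurable fun ω => ENNReal.ofReal (k * H ω)) hm hind
  have h1 : ∫⁻ ω, ENNReal.ofReal (k * H ω) ∂P = ENNReal.ofReal k := by
    have h2 : ∫⁻ ω, ENNReal.ofReal (H ω) ∂P = 1 := by
      rw [← lintegral_ofReal_expMeasure_one]
      exact hH.lintegral_comp (f := fun x => ENNReal.ofReal x) (by fun_prop)
    simp_rw [ENNReal.ofReal_mul hk]
    rw [lintegral_const_mul _ (by fun_prop), h2, mul_one]
  have h3 : ∫⁻ ω, (Set.Iio q).indicator (1 : ℝ → ℝ≥0∞) (U ω) ∂P = ENNReal.ofReal q := by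
    rw [← measure_coin_lt hU hq, ← lintegral_indicator_one (measurableSet_lt hUm measurable_const)]
    rfl
  rw [h1, h3] at h
  rw [mul_comm, ← h]
  refine lintegral_congr fun ω => ?_
  by_cases hω : U ω < q <;> simp [Set.indicator, hω]

/-- Integrates `1 - x ≤ exp (-x)`, so that only the mean of an interference term matters and not its
law. -/
theorem one_sub_lintegral_le_lintegral_exp_neg [IsProbabilityMeasure P] {R : Ω → ℝ≥0∞} (hR : Measurable R)
    (hfin : ∀ ω, R ω ≠ ∞) :
    1 - ∫⁻ ω, R ω ∂P ≤ ∫⁻ ω, ENNReal.ofReal (Real.exp (-(R ω).toReal)) ∂P := by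
  rw [tsub_le_iff_right, ← lintegral_add_right _ hR, ← measure_univ (μ := P), ← lintegral_one]
  refine lintegral_mono fun ω => ?_
  conv_rhs => rw [← ENNReal.ofReal_toReal (hfin ω)]
  rw [← ENNReal.ofReal_add (Real.exp_pos _).le ENNReal.toReal_nonneg]
  simp only [ENNReal.one_le_ofReal]
  have := Real.add_one_le_exp (-(R ω).toReal)
  rw [ENNReal.toReal_ofReal ENNReal.toReal_nonneg]
  linarith

/-- An exponential gain exceeds an independent threshold `Y + b`, while an independent coin
succeeds. -/
theorem coin_mul_laplace_le_measure [IsProbabilityMeasure P] {H U : Ω → ℝ} (hHm : Measurable H) (hUm : Measurable U)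
    (hH : HasLaw H (expMeasure 1) P)
    (hU : HasLaw U (volume.restrict (Set.Icc (0 : ℝ) 1)) P) (hHU : IndepFun H U P)
    {Y : Ω → ℝ≥0∞} (hYm : Measurable Y) (hY : ∀ ω, Y ω ≠ ∞)
    (hind : IndepFun (fun ω => (H ω, U ω)) Y P) {q b : ℝ} (hq : q ≤ 1) (hb : 0 ≤ b) :
    ENNReal.ofReal q * ENNReal.ofReal (Real.exp (-b)) *
        ∫⁻ ω, ENNReal.ofReal (Real.exp (-(Y ω).toReal)) ∂P ≤
      P {ω | U ω < q ∧ Y ω + ENNReal.ofReal b ≤ ENNReal.ofReal (H ω)} := by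
  have hVm : Measurable fun ω => (H ω, U ω) := hHm.prodMk hUm
  let B : Set ((ℝ × ℝ) × ℝ≥0∞) :=
    {z | z.1.2 < q ∧ z.2 + ENNReal.ofReal b ≤ ENNReal.ofReal z.1.1}
  have hB₁ : MeasurableSet {z : (ℝ × ℝ) × ℝ≥0∞ | z.1.2 < q} :=
    measurableSet_lt (by fun_prop) (by fun_prop)
  have hB₂ : MeasurableSet {z : (ℝ × ℝ) × ℝ≥0∞ |
      z.2 + ENNReal.ofReal b ≤ ENNReal.ofReal z.1.1} :=
    measurableSet_le (by fun_prop) (by fun_prop)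
  have hB : MeasurableSet B := hB₁.inter hB₂
  have h1 : P {ω | U ω < q ∧ Y ω + ENNReal.ofReal b ≤ ENNReal.ofReal (H ω)} =
      (P.map fun ω => ((H ω, U ω), Y ω)) B := by
    rw [Measure.map_apply (hVm.prodMk hYm) hB]; rfl
  -- Conditioning on `Y`: the joint law is a product, so the section at each value of `Y` is
  -- measured separately.
  rw [h1, (indepFun_iff_map_prod_eq_prod_map_map hVm.aemeasurable hYm.aemeasurable).1 hind,
    Measure.prod_apply_symm hB, lintegral_map (measurable_measure_prodMk_right hB) hYm,
    ← lintegral_const_mul _ (by fun_prop)]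
  refine lintegral_mono fun ω' => ?_
  have hYb : 0 ≤ (Y ω').toReal + b := add_nonneg ENNReal.toReal_nonneg hb
  rw [Measure.map_apply hVm (measurable_prodMk_right hB)]
  have hsub : (H ⁻¹' Set.Ioi ((Y ω').toReal + b)) ∩ (U ⁻¹' Set.Iio q) ⊆
      (fun ω => (H ω, U ω)) ⁻¹' ((fun x => (x, Y ω')) ⁻¹' B) := by
    rintro ω ⟨h1, h2⟩
    refine ⟨h2, ?_⟩
    change Y ω' + ENNReal.ofReal b ≤ ENNReal.ofReal (H ω)
    rw [← ENNReal.ofReal_toReal (hY ω'), ← ENNReal.ofReal_add ENNReal.toReal_nonneg hb]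
    exact ENNReal.ofReal_le_ofReal (le_of_lt h1)
  refine le_trans (le_of_eq ?_) (measure_mono hsub)
  rw [hHU.measure_inter_preimage_eq_mul _ _ measurableSet_Ioi measurableSet_Iio]
  have h2 : P (H ⁻¹' Set.Ioi ((Y ω').toReal + b)) =
      ENNReal.ofReal (Real.exp (-((Y ω').toReal + b))) :=
    (hH.measure_eq (p := fun x => (Y ω').toReal + b < x) measurableSet_Ioi).trans
      (expMeasure_one_Ioi hYb)
  have h3 : P (U ⁻¹' Set.Iio q) = ENNReal.ofReal q := measure_coin_lt hU hq
  rw [h2, h3, neg_add, Real.exp_add, ENNReal.ofReal_mul (Real.exp_pos _).le]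
  ring

/-- Lower bound for the success probability in one slot, where `g n` computes the (normalized)
contribution of the `n`-th transmitter to the interference from its marks. -/
theorem le_measure_coin_and_tsum_le [IsProbabilityMeasure P] {H U : ℕ → Ω → ℝ} (hHm : ∀ n, Measurable (H n))
    (hUm : ∀ n, Measurable (U n)) (hH : ∀ n, HasLaw (H n) (expMeasure 1) P)
    (hU : ∀ n, HasLaw (U n) (volume.restrict (Set.Icc (0 : ℝ) 1)) P)
    (hHU : ∀ n, IndepFun (H n) (U n) P) (hind : iIndepFun (fun n ω => (H n ω, U n ω)) P)
    {g : ℕ → ℝ × ℝ → ℝ≥0∞} (hgm : ∀ n, Measurable (g n)) (hg : ∀ n v, g n v ≠ ∞)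
    (n₀ : ℕ) {q b : ℝ} (hq : q ≤ 1) (hb : 0 ≤ b) {D : ℝ≥0∞}
    (hD : ∀ F : Finset ℕ, D ≤ ∏ n ∈ F, (1 - ∫⁻ ω, g n (H n ω, U n ω) ∂P)) :
    ENNReal.ofReal q * ENNReal.ofReal (Real.exp (-b)) * D ≤
      P {ω | U n₀ ω < q ∧
        (∑' n, if n = n₀ then 0 else g n (H n ω, U n ω)) + ENNReal.ofReal b ≤
          ENNReal.ofReal (H n₀ ω)} := by
  have hRm : ∀ n, Measurable fun ω => g n (H n ω, U n ω) :=
    fun n => (hgm n).comp ((hHm n).prodMk (hUm n))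
  have hpartial : ∀ k ω, ∑ n ∈ Finset.range k, (if n = n₀ then 0 else g n (H n ω, U n ω)) =
      ∑ n ∈ (Finset.range k).erase n₀, g n (H n ω, U n ω) := by
    intro k ω
    rw [← Finset.filter_ne', Finset.sum_filter]
    exact Finset.sum_congr rfl fun n _ => by by_cases h : n = n₀ <;> simp [h]
  -- Truncating the interference gives decreasing events. Their intersection is the full event
  -- because the inequality is non-strict and hence survives the supremum of the partial sums.
  let s : ℕ → Set Ω := fun k => {ω | U n₀ ω < q ∧
    (∑ n ∈ (Finset.range k).erase n₀, g n (H n ω, U n ω)) + ENNReal.ofReal b ≤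
      ENNReal.ofReal (H n₀ ω)}
  have hsm : ∀ k, MeasurableSet (s k) := fun k =>
    (measurableSet_lt (hUm n₀) measurable_const).inter
      (measurableSet_le ((Finset.measurable_fun_sum _ fun n _ => hRm n).add_const _)
        (hHm n₀).ennreal_ofReal)
  have hanti : Antitone s := by
    intro k l hkl ω hω
    refine ⟨hω.1, le_trans ?_ hω.2⟩
    gcongr
  have hset : {ω | U n₀ ω < q ∧
        (∑' n, if n = n₀ then 0 else g n (H n ω, U n ω)) + ENNReal.ofReal b ≤
          ENNReal.ofReal (H n₀ ω)} = ⋂ k, s k := by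
    ext ω
    simp only [s, Set.mem_ofPred_eq, Set.mem_iInter, ENNReal.tsum_eq_iSup_nat, hpartial,
      ENNReal.iSup_add, iSup_le_iff]
    exact ⟨fun h k => ⟨h.1, h.2 k⟩, fun h => ⟨(h 0).1, fun k => (h k).2⟩⟩
  rw [hset, hanti.measure_iInter (fun k => (hsm k).nullMeasurableSet) ⟨0, measure_ne_top _ _⟩]
  refine le_iInf fun k => ?_
  set F := (Finset.range k).erase n₀ with hF
  have hfin : ∀ ω, ∑ n ∈ F, g n (H n ω, U n ω) ≠ ∞ :=
    fun ω => ENNReal.sum_ne_top.2 fun n _ => hg n _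
  have hVm : ∀ n, Measurable fun ω => (H n ω, U n ω) := fun n => (hHm n).prodMk (hUm n)
  have hind' : IndepFun (fun ω => (H n₀ ω, U n₀ ω))
      (fun ω => ∑ n ∈ F, g n (H n ω, U n ω)) P := by
    have h := hind.indepFun_finset {n₀} F (by simp [hF]) hVm
    have hφ : Measurable fun x : ({n₀} : Finset ℕ) → ℝ × ℝ =>
        x ⟨n₀, Finset.mem_singleton_self n₀⟩ := measurable_pi_apply _
    have hψ : Measurable fun x : F → ℝ × ℝ => ∑ n : F, g n (x n) :=
      Finset.measurable_fun_sum _ fun n _ => (hgm n).comp (measurable_pi_apply n)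
    have h' := h.comp hφ hψ
    have hY : (fun ω => ∑ n ∈ F, g n (H n ω, U n ω)) =
        fun ω => ∑ n : F, g n (H n ω, U n ω) :=
      funext fun ω => (Finset.sum_coe_sort F fun n => g n (H n ω, U n ω)).symm
    rw [hY]
    exact h'
  refine le_trans ?_ (coin_mul_laplace_le_measure (hHm n₀) (hUm n₀) (hH n₀) (hU n₀) (hHU n₀)
    (Finset.measurable_fun_sum _ fun n _ => hRm n) hfin hind' hq hb)
  gcongr
  refine (hD F).trans ?_
  have hprod : ∀ ω, ENNReal.ofReal (Real.exp (-(∑ n ∈ F, g n (H n ω, U n ω)).toReal)) =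
      ∏ n ∈ F, ENNReal.ofReal (Real.exp (-(g n (H n ω, U n ω)).toReal)) := by
    intro ω
    rw [ENNReal.toReal_sum fun n _ => hg n _, ← Finset.sum_neg_distrib, Real.exp_sum,
      ENNReal.ofReal_prod_of_nonneg fun n _ => (Real.exp_pos _).le]
  simp_rw [hprod]
  rw [lintegral_prod_eq_prod_lintegral_of_indepFun F
    (fun n ω => ENNReal.ofReal (Real.exp (-(g n (H n ω, U n ω)).toReal)))
    (hind.comp (fun n v => ENNReal.ofReal (Real.exp (-(g n v).toReal)))
      fun n => by have := hgm n; fun_prop)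
    (fun n => by have := hRm n; fun_prop)]
  exact Finset.prod_le_prod' fun n _ =>
    one_sub_lintegral_le_lintegral_exp_neg (hRm n) fun ω => hg n _

/-- `E i` is determined by the marks of slot `s i` alone. As `s` is injective, the first `t` events
and the next one use disjoint families of marks. -/
theorem measure_biInter_lt_eq_prod_of_iIndep {m : ℕ × ℕ → MeasurableSpace Ω}
    (hm : ∀ i, m i ≤ ‹MeasurableSpace Ω›) (hind : iIndep m P) {s : ℕ → ℕ}
    (hs : Function.Injective s) {E : ℕ → Set Ω}
    (hE : ∀ i, MeasurableSet[⨆ n, m (n, s i)] (E i)) (t : ℕ) [IsProbabilityMeasure P] :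
    P {ω | ∀ i < t, ω ∈ E i} = ∏ i ∈ Finset.range t, P (E i) := by
  induction t with
  | zero => simp
  | succ t ih =>
    have hset : {ω | ∀ i < t + 1, ω ∈ E i} = {ω | ∀ i < t, ω ∈ E i} ∩ E t := by
      ext ω
      simp only [Set.mem_ofPred_eq, Set.mem_inter_iff, Nat.lt_succ_iff_lt_or_eq]
      exact ⟨fun h => ⟨fun i hi => h i (Or.inl hi), h t (Or.inr rfl)⟩, fun h i hi =>
        hi.elim (h.1 i) fun hi => hi ▸ h.2⟩
    have hST : Disjoint {p : ℕ × ℕ | ∃ i < t, p.2 = s i} {p : ℕ × ℕ | p.2 = s t} := by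
      rw [Set.disjoint_left]
      rintro ⟨n, k⟩ ⟨i, hi, hk⟩ hk'
      exact hi.ne (hs (hk.symm.trans hk'))
    have hI := indep_iSup_of_disjoint hm hind hST
    rw [hset, Finset.prod_range_succ, ← ih]
    refine (Indep_iff _ _ _).1 hI _ _ ?_ ?_
    · simp only [Set.ofPred_forall]
      refine MeasurableSet.iInter fun i => MeasurableSet.iInter fun hi => ?_
      refine (iSup_le fun n => ?_ : (⨆ n, m (n, s i)) ≤ _) _ (hE i)
      exact le_iSup₂_of_le (n, s i) ⟨i, hi, rfl⟩ le_rfl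
    · refine (iSup_le fun n => ?_ : (⨆ n, m (n, s t)) ≤ _) _ (hE t)
      exact le_iSup₂_of_le (n, s t) rfl le_rfl

end Probability

/-! ### Path-loss bounds and the interference factor. -/

theorem pathLoss_pos (α d : ℝ) : 0 < pathLoss α d := by
  unfold pathLoss
  positivity

theorem pathLoss_le_one {α : ℝ} (hα : 0 ≤ α) (d : ℝ) : pathLoss α d ≤ 1 :=
  Real.rpow_le_one_of_one_le_of_nonpos (le_max_left 1 d) (by linarith)

theorem pathLoss_antitone {α : ℝ} (hα : 0 ≤ α) : Antitone (pathLoss α) := fun x y h =>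
  Real.rpow_le_rpow_of_nonpos (by positivity) (max_le_max_left 1 h) (by linarith)

/-- The reciprocal of `1 - κ ℓ(k)`, for `k` the integral part of the distance to the origin: a
bound for the factor by which a base station at `z` prolongs the delay. -/
def delayFactor (α κ : ℝ) (k : ℕ) : ℝ≥0∞ := (ENNReal.ofReal (1 - κ * pathLoss α k))⁻¹

/-- The factor by which the interference from all the base stations `x` prolongs the delay. -/
def interferenceFactor (α κ : ℝ) (x : ℕ → Plane) : ℝ≥0∞ :=
  ⨆ m : ℕ, ∏ n ∈ Finset.range m, delayFactor α κ ⌊‖x n‖⌋₊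

theorem mul_pathLoss_lt_one {α κ : ℝ} (hα : 0 ≤ α) (hκ0 : 0 ≤ κ) (hκ : κ < 1) (d : ℝ) :
    κ * pathLoss α d < 1 :=
  lt_of_le_of_lt (mul_le_of_le_one_right hκ0 (pathLoss_le_one hα d)) hκ

theorem one_le_delayFactor {α κ : ℝ} (hκ0 : 0 ≤ κ) (k : ℕ) : 1 ≤ delayFactor α κ k := by
  unfold delayFactor
  rw [ENNReal.one_le_inv, ENNReal.ofReal_le_one]
  have := mul_nonneg hκ0 (pathLoss_pos α k).le
  linarith

theorem prod_delayFactor_le_interferenceFactor {α κ : ℝ} (hκ0 : 0 ≤ κ) (x : ℕ → Plane)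
    (F : Finset ℕ) : ∏ n ∈ F, delayFactor α κ ⌊‖x n‖⌋₊ ≤ interferenceFactor α κ x := by
  obtain ⟨m, hm⟩ := F.exists_nat_subset_range
  refine le_trans ?_ (le_iSup (fun m : ℕ => ∏ n ∈ Finset.range m, delayFactor α κ ⌊‖x n‖⌋₊) m)
  exact Finset.prod_le_prod_of_subset_of_one_le' hm fun n _ _ => one_le_delayFactor hκ0 _

/-- Rounding a distance down can only increase the path loss. After rounding, the bound depends only
on the numbers of points in the annuli. -/
theorem inv_interferenceFactor_le_prod {α κ : ℝ} (hα : 0 ≤ α) (hκ0 : 0 ≤ κ)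
    (x : ℕ → Plane) (F : Finset ℕ) :
    (interferenceFactor α κ x)⁻¹ ≤ ∏ n ∈ F, (1 - ENNReal.ofReal (κ * pathLoss α ‖x n‖)) := by
  have h1 : ∀ n, (delayFactor α κ ⌊‖x n‖⌋₊)⁻¹ ≤ 1 - ENNReal.ofReal (κ * pathLoss α ‖x n‖) := by
    intro n
    have h0 := mul_nonneg hκ0 (pathLoss_pos α ‖x n‖).le
    rw [delayFactor, inv_inv, ← ENNReal.ofReal_one, ← ENNReal.ofReal_sub _ h0]
    apply ENNReal.ofReal_le_ofReal
    have := mul_le_mul_of_nonneg_left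
      (pathLoss_antitone hα (Nat.floor_le (norm_nonneg (x n)))) hκ0
    linarith
  refine le_trans ?_ (Finset.prod_le_prod' fun n _ => h1 n)
  rw [← ENNReal.prod_inv_distrib]
  · exact ENNReal.inv_le_inv.2 (prod_delayFactor_le_interferenceFactor hκ0 x F)
  · intro i _ j _ _
    exact Or.inl (zero_lt_one.trans_le (one_le_delayFactor hκ0 _)).ne'

/-! ### Success probability and mean delay for a fixed geometry. -/

namespace Realization

/-- The realization with the same locations and schedule as `w`, but other fading gains and
coins. -/
def withMarks (w : Realization) (f c : ℕ → ℕ → ℝ) : Realization :=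
  { w with fading := f, coin := c }

variable {Ω : Type*} [MeasurableSpace Ω] {P : Measure Ω} [IsProbabilityMeasure P]

/-- The success probability in a slot dedicated to the typical user, for given locations and
schedule. -/
theorem le_measure_lt_sinr (w : Realization) {H U : Ω → ℕ → ℕ → ℝ}
    {s : ℕ} (hHm : ∀ n, Measurable fun ω => H ω n s) (hUm : ∀ n, Measurable fun ω => U ω n s)
    (hH : ∀ n, HasLaw (fun ω => H ω n s) (expMeasure 1) P)
    (hU : ∀ n, HasLaw (fun ω => U ω n s) (volume.restrict (Set.Icc (0 : ℝ) 1)) P)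
    (hHU : ∀ n, IndepFun (fun ω => H ω n s) (fun ω => U ω n s) P)
    (hind : iIndepFun (fun n ω => (H ω n s, U ω n s)) P)
    (hcell : 0 ∈ w.cell w.servingBS) (hs : w.sched w.servingBS s = 0)
    {α β β' γ N M ε : ℝ} (hα : 0 ≤ α) (hβ : 0 ≤ β) (hββ' : β < β') (hγ : 0 < γ)
    (hN : 0 < N) (hM : 0 < M) (hε : 0 < ε) (hε' : ε < 1) :
    ENNReal.ofReal ((1 - ε) * pathLoss α (w.userDist 0)) *
        ENNReal.ofReal (Real.exp (-(β' * N / (M / (1 - ε))))) *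
        (interferenceFactor α (β' * γ * (1 - ε)) w.bs)⁻¹ ≤
      P {ω | ENNReal.ofReal β < (w.withMarks (H ω) (U ω)).sinr α γ N
        (powerControl α M (M / (1 - ε))) s} := by
  classical
  have hε1 : 0 < 1 - ε := by linarith
  have hβ' : 0 < β' := by linarith
  have hc : 0 < M / (1 - ε) := by positivity
  have hκ0 : 0 ≤ β' * γ * (1 - ε) := by positivity
  set S := powerControl α M (M / (1 - ε)) with hS
  have hprob : ∀ d, S.prob d = (1 - ε) * pathLoss α d := by
    intro d
    have := (pathLoss_pos α d).ne'
    simp only [hS, powerControl]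
    field_simp
  have hprob1 : ∀ d, S.prob d ≤ 1 := by
    intro d
    rw [hprob]
    have := pathLoss_le_one hα d
    have := pathLoss_pos α d
    nlinarith
  have hpower : ∀ d, S.power d = M / (1 - ε) * (pathLoss α d)⁻¹ := fun d => rfl
  have hpower0 : ∀ d, 0 ≤ S.power d := fun d => by
    have := (pathLoss_pos α d).le
    rw [hpower]; positivity
  -- Dividing the success condition at threshold `β'` by `c = M / (1 - ε)` turns it into `a I + β' N
  -- / c ≤ h`.
  set a : ℝ := β' * γ / (M / (1 - ε)) with ha
  have ha0 : 0 ≤ a := by positivity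
  let dst : ℕ → ℝ := fun n => w.userDist (w.sched n s)
  let g : ℕ → ℝ × ℝ → ℝ≥0∞ := fun n v =>
    if w.sched n s ∈ w.cell n ∧ v.2 < S.prob (dst n) then
      ENNReal.ofReal (a * (S.power (dst n) * v.1 * pathLoss α ‖w.bs n‖)) else 0
  have hgm : ∀ n, Measurable (g n) := by
    intro n
    have hset : MeasurableSet {v : ℝ × ℝ | v.2 < S.prob (dst n)} :=
      measurableSet_lt (by fun_prop) (by fun_prop)
    exact Measurable.ite ((MeasurableSet.const _).inter hset) (by fun_prop) measurable_const
  have hg : ∀ n v, g n v ≠ ∞ := by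
    intro n v
    simp only [g]
    split_ifs <;> simp
  -- Transmission probability times power is `M` whatever the served distance, so `dst n` cancels. A
  -- silent station only decreases the left side.
  have hgint : ∀ n, ∫⁻ ω, g n (H ω n s, U ω n s) ∂P ≤
      ENNReal.ofReal (β' * γ * (1 - ε) * pathLoss α ‖w.bs n‖) := by
    intro n
    have hk : 0 ≤ a * (S.power (dst n) * pathLoss α ‖w.bs n‖) :=
      mul_nonneg ha0 (mul_nonneg (hpower0 _) (pathLoss_pos _ _).le)
    calc ∫⁻ ω, g n (H ω n s, U ω n s) ∂P
        ≤ ∫⁻ ω, {ω | U ω n s < S.prob (dst n)}.indicator (fun ω =>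
            ENNReal.ofReal (a * (S.power (dst n) * pathLoss α ‖w.bs n‖) * H ω n s)) ω ∂P := by
          refine lintegral_mono fun ω => ?_
          simp only [g, Set.indicator, Set.mem_ofPred_eq]
          split_ifs with h1 h2
          · exact le_of_eq (by ring_nf)
          · exact absurd h1.2 h2
          · exact zero_le
          · exact le_rfl
      _ = _ := lintegral_thinned_exp (hHm n) (hUm n) (hH n) (hU n) (hHU n) (hprob1 _) hk
      _ = ENNReal.ofReal (β' * γ * (1 - ε) * pathLoss α ‖w.bs n‖) := by
          rw [← ENNReal.ofReal_mul (by rw [hprob]; exact mul_nonneg hε1.le (pathLoss_pos _ _).le),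
            hprob, hpower, ha]
          congr 1
          have := (pathLoss_pos α (dst n)).ne'
          field_simp
  have hD : ∀ F : Finset ℕ, (interferenceFactor α (β' * γ * (1 - ε)) w.bs)⁻¹ ≤
      ∏ n ∈ F, (1 - ∫⁻ ω, g n (H ω n s, U ω n s) ∂P) := fun F =>
    (inv_interferenceFactor_le_prod hα hκ0 w.bs F).trans
      (Finset.prod_le_prod' fun n _ => tsub_le_tsub_left (hgint n) 1)
  have key := le_measure_coin_and_tsum_le (P := P) hHm hUm hH hU hHU hind hgm hg w.servingBS
    (hprob1 (w.userDist 0)) (b := β' * N / (M / (1 - ε))) (by positivity) hD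
  rw [hprob] at key
  refine key.trans (measure_mono ?_)
  rintro ω ⟨hω1, hω2⟩
  set w' := w.withMarks (H ω) (U ω) with hw'
  have hpow : w'.receivedPower α S w'.servingBS s =
      ENNReal.ofReal (M / (1 - ε) * H ω w.servingBS s) := by
    have htr : w'.Transmits S w'.servingBS s := by
      refine ⟨?_, ?_⟩
      · change w.sched w.servingBS s ∈ w.cell w.servingBS
        rw [hs]; exact hcell
      · change U ω w.servingBS s < S.prob (w.userDist (w.sched w.servingBS s))
        rw [hs, hprob]; exact hω1
    rw [receivedPower, if_pos htr]
    change ENNReal.ofReal (S.power (w.userDist (w.sched w.servingBS s)) * H ω w.servingBS s *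
      pathLoss α ‖w.bs w.servingBS‖) = _
    have hd : w.userDist 0 = ‖w.bs w.servingBS‖ := dist_zero_right _
    rw [hs, hpower, hd]
    congr 1
    have := (pathLoss_pos α ‖w.bs w.servingBS‖).ne'
    field_simp
  have hint : (∑' n, if n = w.servingBS then 0 else g n (H ω n s, U ω n s)) =
      ENNReal.ofReal a * w'.interference α S s := by
    rw [interference_eq_tsum, ← ENNReal.tsum_mul_left]
    refine tsum_congr fun n => ?_
    change _ = ENNReal.ofReal a * (if n = w.servingBS then 0 else w'.receivedPower α S n s)
    split_ifs with hn
    · simp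
    · simp only [g, receivedPower]
      by_cases ht : w.sched n s ∈ w.cell n ∧ U ω n s < S.prob (dst n)
      · rw [if_pos ht, if_pos (show w'.Transmits S n s from ht), ← ENNReal.ofReal_mul ha0]
        rfl
      · rw [if_neg ht, if_neg (show ¬ w'.Transmits S n s from ht), mul_zero]
  rw [hint] at hω2
  set I := w'.interference α S s with hI
  have h3 : ENNReal.ofReal β' * (ENNReal.ofReal γ * I + ENNReal.ofReal N) ≤
      ENNReal.ofReal (M / (1 - ε) * H ω w.servingBS s) := by
    have h := mul_le_mul_right hω2 (ENNReal.ofReal (M / (1 - ε)))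
    rw [← ENNReal.ofReal_mul hc.le] at h
    refine le_trans (le_of_eq ?_) h
    have e1 : M / (1 - ε) * a = β' * γ := by rw [ha]; field_simp
    have e2 : M / (1 - ε) * (β' * N / (M / (1 - ε))) = β' * N := by field_simp
    rw [mul_add, mul_add, ← mul_assoc, ← mul_assoc, ← ENNReal.ofReal_mul hc.le,
      ← ENNReal.ofReal_mul hc.le, ← ENNReal.ofReal_mul hβ'.le, ← ENNReal.ofReal_mul hβ'.le, e1, e2]
  -- Infinite interference is excluded by `h3`, whose right side is finite.
  have hdfin : ENNReal.ofReal γ * I + ENNReal.ofReal N ≠ ∞ := by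
    intro h
    rw [h, ENNReal.mul_top (by simpa using hβ')] at h3
    exact ENNReal.ofReal_ne_top (top_le_iff.1 h3)
  have hd0 : ENNReal.ofReal γ * I + ENNReal.ofReal N ≠ 0 := by
    simp [hN]
  change ENNReal.ofReal β < w'.receivedPower α S w'.servingBS s /
    (ENNReal.ofReal γ * I + ENNReal.ofReal N)
  rw [hpow, ENNReal.lt_div_iff_mul_lt (Or.inl hd0) (Or.inl hdfin)]
  -- The gap `β < β'` turns the non-strict bound into strict success.
  refine lt_of_lt_of_le ?_ h3
  exact ENNReal.mul_lt_mul_left hd0 hdfin ((ENNReal.ofReal_lt_ofReal_iff hβ').2 hββ')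

/-- The expected delay for given locations and schedule. -/
theorem lintegral_delay_withMarks_le (w : Realization) (hw : w.IsRoundRobin)
    {H U : Ω → ℕ → ℕ → ℝ}
    (hHm : ∀ n s, Measurable fun ω => H ω n s) (hUm : ∀ n s, Measurable fun ω => U ω n s)
    (hH : ∀ n s, HasLaw (fun ω => H ω n s) (expMeasure 1) P)
    (hU : ∀ n s, HasLaw (fun ω => U ω n s) (volume.restrict (Set.Icc (0 : ℝ) 1)) P)
    (hHU : ∀ n s, IndepFun (fun ω => H ω n s) (fun ω => U ω n s) P)
    (hind : iIndepFun (fun (i : ℕ × ℕ) ω => (H ω i.1 i.2, U ω i.1 i.2)) P)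
    {α β β' γ N M ε : ℝ} (hα : 0 ≤ α) (hβ : 0 ≤ β) (hββ' : β < β') (hγ : 0 < γ)
    (hN : 0 < N) (hM : 0 < M) (hε : 0 < ε) (hε' : ε < 1) :
    ∫⁻ ω, (((w.withMarks (H ω) (U ω)).delay α β γ N (powerControl α M (M / (1 - ε))) : ℕ∞) :
        ℝ≥0∞) ∂P ≤
      (ENNReal.ofReal ((1 - ε) * pathLoss α (w.userDist 0)) *
        ENNReal.ofReal (Real.exp (-(β' * N / (M / (1 - ε))))) *
        (interferenceFactor α (β' * γ * (1 - ε)) w.bs)⁻¹)⁻¹ := by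
  classical
  set S := powerControl α M (M / (1 - ε)) with hS
  set p := ENNReal.ofReal ((1 - ε) * pathLoss α (w.userDist 0)) *
        ENNReal.ofReal (Real.exp (-(β' * N / (M / (1 - ε))))) *
        (interferenceFactor α (β' * γ * (1 - ε)) w.bs)⁻¹ with hp
  have hcell : 0 ∈ w.cell w.servingBS := rfl
  -- Infinitely many dedicated slots make `Nat.nth` strictly increasing, with no default values.
  have hinf : (Set.ofPred fun s => w.sched w.servingBS s = 0).Infinite :=
    Nat.frequently_atTop_iff_infinite.1 <| Filter.frequently_atTop.2 fun s =>
      (hw w.servingBS ⟨0, hcell⟩).2.1 0 hcell s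
  let E : ℕ → Set Ω := fun i =>
    {ω | ¬ ENNReal.ofReal β < (w.withMarks (H ω) (U ω)).sinr α γ N S (w.dedicatedSlot i)}
  let m : ℕ × ℕ → MeasurableSpace Ω := fun i =>
    MeasurableSpace.comap (fun ω => (H ω i.1 i.2, U ω i.1 i.2)) inferInstance
  have hm : ∀ i, m i ≤ ‹MeasurableSpace Ω› := fun i =>
    ((hHm i.1 i.2).prodMk (hUm i.1 i.2)).comap_le
  have hE : ∀ i, MeasurableSet[⨆ n, m (n, w.dedicatedSlot i)] (E i) := by
    intro i
    set s := w.dedicatedSlot i with hs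
    let F : MeasurableSpace Ω := ⨆ n, m (n, s)
    have hmark : ∀ n, Measurable[F] fun ω => (H ω n s, U ω n s) := fun n =>
      (comap_measurable _).mono (le_iSup (fun n => m (n, s)) n) le_rfl
    -- Copying the marks of slot `s` to all slots leaves the SINR in slot `s` unchanged and gives a
    -- family measurable for the marks of that slot alone.
    have hfam : @MeasurableFamily Ω F
        fun ω => w.withMarks (fun n _ => H ω n s) (fun n _ => U ω n s) :=
      { bs := measurable_const
        otherUser := measurable_const
        sched := measurable_const
        fading := measurable_pi_iff.2 fun n => measurable_pi_iff.2 fun _ => (hmark n).fst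
        coin := measurable_pi_iff.2 fun n => measurable_pi_iff.2 fun _ => (hmark n).snd }
    have := @MeasurableFamily.sinr Ω F _ hfam α γ N S (measurable_powerControl_prob _ _ _)
      (measurable_powerControl_power _ _ _) s
    exact (measurableSet_lt measurable_const this).compl
  have hEm : ∀ i, MeasurableSet (E i) := fun i => (iSup_le fun n => hm _ :
    (⨆ n, m (n, w.dedicatedSlot i)) ≤ _) _ (hE i)
  have hEc : ∀ i, p ≤ P (E i)ᶜ := by
    intro i
    have hslot : w.sched w.servingBS (w.dedicatedSlot i) = 0 := Nat.nth_mem_of_infinite hinf i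
    have h := le_measure_lt_sinr w (fun n => hHm n (w.dedicatedSlot i))
      (fun n => hUm n (w.dedicatedSlot i)) (fun n => hH n _) (fun n => hU n _)
      (fun n => hHU n _)
      (hind.precomp (g := fun n => (n, w.dedicatedSlot i)) fun a b h => (Prod.mk.inj h).1)
      hcell hslot hα hβ hββ' hγ hN hM hε hε'
    refine h.trans (measure_mono fun ω hω => ?_)
    exact fun h' => h' hω
  have hEp : ∀ i, P (E i) ≤ 1 - p := by
    intro i
    have h2 : P (E i) = 1 - P (E i)ᶜ := by
      have := prob_compl_eq_one_sub (μ := P) (hEm i).compl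
      rwa [compl_compl] at this
    rw [h2]
    exact tsub_le_tsub_left (hEc i) 1
  have hterm : ∀ t : ℕ, P {ω | ∀ i < t, ω ∈ E i} ≤ (1 - p) ^ t := by
    intro t
    rw [measure_biInter_lt_eq_prod_of_iIndep hm hind.iIndep (Nat.nth_strictMono hinf).injective hE]
    calc ∏ i ∈ Finset.range t, P (E i) ≤ ∏ i ∈ Finset.range t, (1 - p) :=
          Finset.prod_le_prod' fun i _ => hEp i
      _ = (1 - p) ^ t := by simp
  have hmt : ∀ t : ℕ, MeasurableSet {ω | ∀ i < t, ω ∈ E i} := by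
    intro t
    simp only [Set.ofPred_forall]
    exact MeasurableSet.iInter fun i => MeasurableSet.iInter fun _ => hEm i
  have hdelay : ∀ ω, (((w.withMarks (H ω) (U ω)).delay α β γ N S : ℕ∞) : ℝ≥0∞) =
      ∑' t : ℕ, {ω | ∀ i < t, ω ∈ E i}.indicator 1 ω := by
    intro ω
    rw [toENNReal_delay]
    refine tsum_congr fun t => ?_
    by_cases h : ∀ i < t, ω ∈ E i
    · rw [Set.indicator_of_mem (show ω ∈ {ω | ∀ i < t, ω ∈ E i} from h)]
      exact if_pos h
    · rw [Set.indicator_of_notMem (show ω ∉ {ω | ∀ i < t, ω ∈ E i} from h)]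
      exact if_neg h
  simp_rw [hdelay]
  rw [lintegral_tsum fun t => (measurable_one.indicator (hmt t)).aemeasurable]
  simp_rw [fun t => lintegral_indicator_one (μ := P) (hmt t)]
  refine (ENNReal.tsum_le_tsum hterm).trans ?_
  rw [ENNReal.tsum_geometric]
  refine ENNReal.inv_le_inv.2 ?_
  have hp1 : p ≤ 1 := (hEc 0).trans prob_le_one
  exact (ENNReal.sub_sub_cancel ENNReal.one_ne_top hp1).ge

end Realization
-- Moments under the Poisson process of base stations.
section Poisson

theorem lintegral_pow_poissonMeasure (m : ℝ≥0) {r : ℝ} (hr : 0 ≤ r) :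
    ∫⁻ n, ENNReal.ofReal r ^ n ∂(poissonMeasure m) =
      ENNReal.ofReal (Real.exp (m * (r - 1))) := by
  rw [lintegral_countable']
  have h1 : ∀ n : ℕ, ENNReal.ofReal r ^ n * poissonMeasure m {n} =
      ENNReal.ofReal (Real.exp (-m) * ((m * r) ^ n / n.factorial)) := by
    intro n
    rw [poissonMeasure_singleton, ← ENNReal.ofReal_pow hr, ← ENNReal.ofReal_mul (by positivity)]
    congr 1
    rw [mul_pow]
    ring
  have hs : HasSum (fun n : ℕ => Real.exp (-m) * ((m * r) ^ n / n.factorial))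
      (Real.exp (-m) * Real.exp (m * r)) := by
    have := NormedSpace.expSeries_div_hasSum_exp (𝔸 := ℝ) (m * r : ℝ)
    rw [← Real.exp_eq_exp_ℝ] at this
    exact this.mul_left _
  rw [tsum_congr h1, ← ENNReal.ofReal_tsum_of_nonneg (fun n => by positivity) hs.summable,
    hs.tsum_eq, ← Real.exp_add]
  congr 2
  ring

variable {Ω : Type*} [MeasurableSpace Ω] {P : Measure Ω} {lam : ℝ} {X : Ω → ℕ → Plane}

theorem measurable_pointCount (hX : Measurable X) {A : Set Plane} (hA : MeasurableSet A) :
    Measurable fun ω => pointCount (X ω) A := by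
  have h : Measurable fun ω => ((pointCount (X ω) A : ℕ∞) : ℝ≥0∞) := by
    have h1 : ∀ ω, ((pointCount (X ω) A : ℕ∞) : ℝ≥0∞) = ∑' n, A.indicator 1 (X ω n) := by
      intro ω
      rw [pointCount, ← ENNReal.tsum_set_one, tsum_subtype {n | X ω n ∈ A} fun _ => (1 : ℝ≥0∞)]
      rfl
    simp_rw [h1]
    exact Measurable.tsum fun n =>
      (measurable_one.indicator hA).comp (measurable_pi_iff.1 hX n)
  refine measurable_to_countable' fun k => ?_
  have h2 : (fun ω => pointCount (X ω) A) ⁻¹' {k} =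
      (fun ω => ((pointCount (X ω) A : ℕ∞) : ℝ≥0∞)) ⁻¹' {(k : ℝ≥0∞)} := by
    ext ω
    simp
  rw [h2]
  exact h (measurableSet_singleton _)

namespace IsPoissonPointProcess

variable (hX : IsPoissonPointProcess P lam X)
include hX

theorem lintegral_comp_pointCount {A : Set Plane} (hA : MeasurableSet A) (hA' : volume A ≠ ∞)
    (f : ℕ∞ → ℝ≥0∞) :
    ∫⁻ ω, f (pointCount (X ω) A) ∂P =
      ∫⁻ n : ℕ, f n ∂(poissonMeasure (lam.toNNReal * (volume A).toNNReal)) := by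
  rw [(hX.law A hA hA').lintegral_comp (f := f) (by fun_prop)]
  exact lintegral_map (by fun_prop) (by fun_prop)

theorem measure_pointCount_eq_zero {A : Set Plane} (hA : MeasurableSet A) (hA' : volume A ≠ ∞)
    (hlam : 0 ≤ lam) :
    P {ω | pointCount (X ω) A = 0} = ENNReal.ofReal (Real.exp (-(lam * (volume A).toReal))) := by
  rw [(hX.law A hA hA').measure_eq (p := fun n => n = 0) (.of_discrete),
    Measure.map_apply (by fun_prop) (.of_discrete)]
  have : (Nat.cast : ℕ → ℕ∞) ⁻¹' {n | n = 0} = {0} := by ext n; simp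
  rw [this, poissonMeasure_singleton]
  simp [hlam, ENNReal.coe_toNNReal_eq_toReal]

/-- Makes `toNat`, which sends `⊤` to `0`, faithful on point counts. -/
theorem ae_pointCount_ne_top {A : Set Plane} (hA : MeasurableSet A) (hA' : volume A ≠ ∞) :
    ∀ᵐ ω ∂P, pointCount (X ω) A ≠ ⊤ := by
  rw [(hX.law A hA hA').ae_iff (p := fun n => n ≠ ⊤) (by fun_prop),
    ae_map_iff (by fun_prop) (.of_discrete)]
  exact Filter.Eventually.of_forall fun n => ENat.natCast_ne_top n

theorem lintegral_pow_pointCount {A : Set Plane} (hA : MeasurableSet A) (hA' : volume A ≠ ∞)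
    (hlam : 0 ≤ lam) {r : ℝ} (hr : 0 ≤ r) :
    ∫⁻ ω, ENNReal.ofReal r ^ (pointCount (X ω) A).toNat ∂P =
      ENNReal.ofReal (Real.exp (lam * (volume A).toReal * (r - 1))) := by
  rw [hX.lintegral_comp_pointCount hA hA' fun n => ENNReal.ofReal r ^ n.toNat]
  simp only [ENat.toNat_natCast]
  rw [lintegral_pow_poissonMeasure _ hr]
  simp [hlam, ENNReal.coe_toNNReal_eq_toReal]

end IsPoissonPointProcess

/-- The points whose distance to the origin has integral part `k`. -/
def annulus (k : ℕ) : Set Plane := {z | ⌊‖z‖⌋₊ = k}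

theorem measurableSet_annulus (k : ℕ) : MeasurableSet (annulus k) :=
  (Nat.measurable_floor.comp measurable_norm) (measurableSet_singleton k)

theorem volume_annulus (k : ℕ) : volume (annulus k) = ENNReal.ofReal (Real.pi * (2 * k + 1)) := by
  have h : annulus k = Metric.ball (0 : Plane) (k + 1) \ Metric.ball 0 k := by
    ext z
    simp only [annulus, Set.mem_ofPred_eq, Set.mem_sdiff, mem_ball_zero_iff, not_lt,
      Nat.floor_eq_iff (norm_nonneg z)]
    exact and_comm
  rw [h, measure_sdiff (Metric.ball_subset_ball (by linarith)) measurableSet_ball.nullMeasurableSet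
    measure_ball_lt_top.ne, EuclideanSpace.volume_ball_fin_two, EuclideanSpace.volume_ball_fin_two,
    ← ENNReal.ofReal_pow (by positivity), ← ENNReal.ofReal_pow (by positivity),
    ← ENNReal.ofReal_mul (by positivity), ← ENNReal.ofReal_mul (by positivity),
    ← ENNReal.ofReal_sub _ (by positivity)]
  congr 1
  ring

theorem pairwise_disjoint_annulus : Pairwise fun i j => Disjoint (annulus i) (annulus j) := by
  intro i j hij
  rw [Set.disjoint_left]
  intro z hi hj
  exact hij (hi.symm.trans hj)

/-- Group the points by annulus: finitely many points meet finitely many annuli, and factors `≥ 1`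
allow the remaining points of those annuli to be added. -/
theorem prod_range_le_prod_pow_pointCount {d : ℕ → ℝ≥0∞} (hd : ∀ k, 1 ≤ d k) {x : ℕ → Plane}
    (hx : ∀ k, pointCount x (annulus k) ≠ ⊤) (m : ℕ) :
    ∃ K, ∏ n ∈ Finset.range m, d ⌊‖x n‖⌋₊ ≤
      ∏ k ∈ Finset.range K, d k ^ (pointCount x (annulus k)).toNat := by
  classical
  obtain ⟨K, hK⟩ := ((Finset.range m).image fun n => ⌊‖x n‖⌋₊).exists_nat_subset_range
  refine ⟨K, ?_⟩
  rw [Finset.prod_comp d fun n => ⌊‖x n‖⌋₊]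
  refine le_trans (Finset.prod_le_prod' (g := fun k => d k ^ (pointCount x (annulus k)).toNat)
    fun k _ => ?_)
    (Finset.prod_le_prod_of_subset_of_one_le' hK fun k _ _ => one_le_pow₀ (hd k))
  refine pow_le_pow_right₀ (hd k) ?_
  rw [← ENat.natCast_le_natCast, ENat.natCast_toNat (hx k), ← Set.encard_coe_eq_coe_finsetCard, pointCount]
  refine Set.encard_le_encard fun n hn => ?_
  exact (Finset.mem_filter.1 hn).2

/-- The square is dominated by a monotone limit of products `∏ r k ^ (count in annulus k)`. The
counts are independent Poisson variables of mean `λ π (2 k + 1)`, so their generating functions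
multiply to the exponential of a sum bounded by `c λ`. -/
theorem lintegral_interferenceFactor_sq_le [IsProbabilityMeasure P]
    (hX : IsPoissonPointProcess P lam X)
    (hlam : 0 ≤ lam) {α κ : ℝ} (hα : 0 ≤ α) (hκ0 : 0 ≤ κ) (hκ : κ < 1) {c : ℝ}
    (hc : ∀ K : ℕ, ∑ k ∈ Finset.range K,
      Real.pi * (2 * k + 1) * (((1 - κ * pathLoss α k)⁻¹) ^ 2 - 1) ≤ c) :
    ∫⁻ ω, interferenceFactor α κ (X ω) ^ 2 ∂P ≤ ENNReal.ofReal (Real.exp (c * lam)) := by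
  set r : ℕ → ℝ := fun k => ((1 - κ * pathLoss α k)⁻¹) ^ 2 with hr
  have hpos : ∀ k : ℕ, 0 < 1 - κ * pathLoss α k := fun k =>
    sub_pos.2 (mul_pathLoss_lt_one hα hκ0 hκ k)
  have hd2 : ∀ k, delayFactor α κ k ^ 2 = ENNReal.ofReal (r k) := by
    intro k
    rw [delayFactor, ← ENNReal.ofReal_inv_of_pos (hpos k), hr,
      ENNReal.ofReal_pow (inv_nonneg.2 (hpos k).le)]
  have hvol : ∀ k, volume (annulus k) ≠ ∞ := fun k => by
    rw [volume_annulus]; exact ENNReal.ofReal_ne_top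
  have hfin : ∀ᵐ ω ∂P, ∀ k, pointCount (X ω) (annulus k) ≠ ⊤ :=
    ae_all_iff.2 fun k => hX.ae_pointCount_ne_top (measurableSet_annulus k) (hvol k)
  let G : ℕ → Ω → ℝ≥0∞ := fun K ω =>
    ∏ k ∈ Finset.range K, ENNReal.ofReal (r k) ^ (pointCount (X ω) (annulus k)).toNat
  have hr1 : ∀ k, 1 ≤ ENNReal.ofReal (r k) := fun k => by
    rw [← hd2]; exact one_le_pow₀ (one_le_delayFactor hκ0 k)
  have hle : ∀ᵐ ω ∂P, interferenceFactor α κ (X ω) ^ 2 ≤ ⨆ K, G K ω := by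
    filter_upwards [hfin] with ω hω
    have hcont : interferenceFactor α κ (X ω) ^ 2 =
        ⨆ m : ℕ, (∏ n ∈ Finset.range m, delayFactor α κ ⌊‖X ω n‖⌋₊) ^ 2 :=
      ENNReal.iSup_pow _ 2
    rw [hcont]
    refine iSup_le fun m => ?_
    rw [← Finset.prod_pow]
    simp only [hd2]
    obtain ⟨K, hK⟩ := prod_range_le_prod_pow_pointCount hr1 hω m
    exact hK.trans (le_iSup (fun K => G K ω) K)
  have hpm : ∀ k, Measurable fun ω => ENNReal.ofReal (r k) ^ (pointCount (X ω) (annulus k)).toNat :=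
    fun k => (Measurable.of_discrete (f := fun n : ℕ∞ => ENNReal.ofReal (r k) ^ n.toNat)).comp
      (measurable_pointCount hX.measurable (measurableSet_annulus k))
  have hGm : ∀ K, Measurable (G K) := fun K => Finset.measurable_fun_prod _ fun k _ => hpm k
  have hGmono : ∀ ω, Monotone fun K => G K ω := fun ω K L hKL =>
    Finset.prod_le_prod_of_subset_of_one_le' (Finset.range_mono hKL)
      fun k _ _ => one_le_pow₀ (hr1 k)
  refine (lintegral_mono_ae hle).trans ?_
  rw [lintegral_iSup hGm fun K L hKL ω => hGmono ω hKL]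
  refine iSup_le fun K => ?_
  have hind := hX.indep K (fun i => annulus i) (fun i => measurableSet_annulus i)
    fun i j hij => pairwise_disjoint_annulus (Fin.val_injective.ne hij)
  have hG : ∀ ω, G K ω =
      ∏ i : Fin K, ENNReal.ofReal (r i) ^ (pointCount (X ω) (annulus i)).toNat := fun ω =>
    Finset.prod_range fun k => ENNReal.ofReal (r k) ^ (pointCount (X ω) (annulus k)).toNat
  have hr0 : ∀ k, 0 ≤ r k := fun k => sq_nonneg _
  calc ∫⁻ ω, G K ω ∂P
      = ∏ i : Fin K, ∫⁻ ω, ENNReal.ofReal (r i) ^ (pointCount (X ω) (annulus i)).toNat ∂P := by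
        simp_rw [hG]
        exact lintegral_prod_eq_prod_lintegral_of_indepFun Finset.univ
          (fun (i : Fin K) ω => ENNReal.ofReal (r i) ^ (pointCount (X ω) (annulus i)).toNat)
          (hind.comp (fun (i : Fin K) (n : ℕ∞) => ENNReal.ofReal (r i) ^ n.toNat)
            fun i => .of_discrete) fun i => hpm i
    _ = ∏ i : Fin K, ENNReal.ofReal
          (Real.exp (Real.pi * (2 * (i : ℕ) + 1) * (r i - 1) * lam)) := by
        refine Finset.prod_congr rfl fun i _ => ?_
        rw [hX.lintegral_pow_pointCount (measurableSet_annulus i) (hvol i) hlam (hr0 i),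
          volume_annulus, ENNReal.toReal_ofReal (by positivity)]
        congr 2
        ring
    _ = ENNReal.ofReal (Real.exp
          ((∑ k ∈ Finset.range K, Real.pi * (2 * k + 1) * (r k - 1)) * lam)) := by
        rw [← ENNReal.ofReal_prod_of_nonneg fun i _ => (Real.exp_pos _).le, ← Real.exp_sum,
          Finset.sum_mul, Finset.sum_range]
    _ ≤ ENNReal.ofReal (Real.exp (c * lam)) := by
        apply ENNReal.ofReal_le_ofReal
        exact Real.exp_le_exp.2 (mul_le_mul_of_nonneg_right (hc K) hlam)

/-- The bracket is `O(ℓ(k))` because `κ < 1` keeps the denominators away from `0`, and `∑ k · k ^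
(-α)` converges because `α > 2`. -/
theorem exists_sum_annulus_le {α κ : ℝ} (hα : 2 < α) (hκ0 : 0 ≤ κ) (hκ : κ < 1) :
    ∃ c : ℝ, 0 < c ∧ ∀ K : ℕ, ∑ k ∈ Finset.range K,
      Real.pi * (2 * k + 1) * (((1 - κ * pathLoss α k)⁻¹) ^ 2 - 1) ≤ c := by
  have hα0 : 0 ≤ α := by linarith
  have hsum : Summable fun k : ℕ => (2 * k + 1) * pathLoss α k := by
    rw [← summable_nat_add_iff 1]
    refine Summable.of_nonneg_of_le (fun k => mul_nonneg (by positivity) (pathLoss_pos _ _).le)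
      (fun k => ?_) (((summable_nat_add_iff 1).2
        (Real.summable_nat_rpow.2 (by linarith : 1 - α < -1))).mul_left 3)
    have h1 : pathLoss α ((k + 1 : ℕ) : ℝ) = ((k + 1 : ℕ) : ℝ) ^ (-α) := by
      rw [pathLoss, max_eq_right]
      exact_mod_cast Nat.succ_le_succ (Nat.zero_le k)
    have hk : (0 : ℝ) < ((k + 1 : ℕ) : ℝ) := by positivity
    have h2 : ((k + 1 : ℕ) : ℝ) ^ (1 - α) = ((k + 1 : ℕ) : ℝ) * ((k + 1 : ℕ) : ℝ) ^ (-α) := by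
      rw [sub_eq_add_neg, Real.rpow_add hk, Real.rpow_one]
    rw [h1, h2, ← mul_assoc]
    refine mul_le_mul_of_nonneg_right ?_ (Real.rpow_nonneg hk.le _)
    push_cast
    linarith [(Nat.cast_nonneg k : (0 : ℝ) ≤ k)]
  set C := Real.pi * (2 * ((1 - κ)⁻¹) ^ 2) with hC
  have hterm : ∀ k : ℕ, Real.pi * (2 * k + 1) * (((1 - κ * pathLoss α k)⁻¹) ^ 2 - 1) ≤
      C * ((2 * k + 1) * pathLoss α k) := by
    intro k
    set x := κ * pathLoss α k with hx
    have hx0 : 0 ≤ x := mul_nonneg hκ0 (pathLoss_pos _ _).le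
    have hxκ : x ≤ κ := mul_le_of_le_one_right hκ0 (pathLoss_le_one hα0 _)
    have hxl : x ≤ pathLoss α k := mul_le_of_le_one_left (pathLoss_pos _ _).le hκ.le
    have hx1 : 0 < 1 - x := by linarith
    have h1 : ((1 - x)⁻¹) ^ 2 - 1 = ((1 - x)⁻¹) ^ 2 * (2 * x - x ^ 2) := by
      field_simp
      ring
    have h2 : ((1 - x)⁻¹) ^ 2 - 1 ≤ ((1 - κ)⁻¹) ^ 2 * (2 * pathLoss α k) := by
      rw [h1]
      have h3 : (1 - x)⁻¹ ≤ (1 - κ)⁻¹ := inv_anti₀ (by linarith) (by linarith)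
      refine mul_le_mul (pow_le_pow_left₀ (inv_nonneg.2 hx1.le) h3 2) (by nlinarith) (by nlinarith)
        (by positivity)
    calc Real.pi * (2 * k + 1) * (((1 - x)⁻¹) ^ 2 - 1)
        ≤ Real.pi * (2 * k + 1) * (((1 - κ)⁻¹) ^ 2 * (2 * pathLoss α k)) :=
          mul_le_mul_of_nonneg_left h2 (by positivity)
      _ = C * ((2 * k + 1) * pathLoss α k) := by rw [hC]; ring
  have hC0 : 0 ≤ C := by positivity
  have hnn : ∀ k : ℕ, 0 ≤ C * ((2 * k + 1) * pathLoss α k) := fun k =>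
    mul_nonneg hC0 (mul_nonneg (by positivity) (pathLoss_pos _ _).le)
  refine ⟨∑' k : ℕ, C * ((2 * k + 1) * pathLoss α k) + 1, by
    linarith [(tsum_nonneg hnn : 0 ≤ ∑' k : ℕ, C * ((2 * k + 1) * pathLoss α k))], fun K => ?_⟩
  have h1 := Finset.sum_le_sum fun k (_ : k ∈ Finset.range K) => hterm k
  have h2 := (hsum.mul_left C).sum_le_tsum (Finset.range K) fun k _ => hnn k
  linarith

/-- Local finiteness ensures that a nearest station exists; otherwise the infimum defining
`nearestBS` would be the default index `0`. -/
theorem Realization.userDist_zero_le (w : Realization)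
    (hw : ∀ k, pointCount w.bs (annulus k) ≠ ⊤) (n : ℕ) : w.userDist 0 ≤ ‖w.bs n‖ := by
  have hne : {n | ∀ m, dist (w.bs n) 0 ≤ dist (w.bs m) 0}.Nonempty := by
    have hfin : {n | ‖w.bs n‖ ≤ ‖w.bs 0‖}.Finite := by
      refine ((Finset.range (⌊‖w.bs 0‖⌋₊ + 1)).finite_toSet.biUnion (t := fun k =>
        {n | w.bs n ∈ annulus k}) fun k _ => Set.encard_ne_top_iff.1 (hw k)).subset fun n hn => ?_
      refine Set.mem_biUnion (x := ⌊‖w.bs n‖⌋₊) ?_ rfl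
      simp only [Finset.coe_range, Set.mem_Iio, Nat.lt_succ_iff]
      exact Nat.floor_le_floor hn
    obtain ⟨n, hn, hmin⟩ := hfin.exists_minimalFor (fun n => ‖w.bs n‖) _ ⟨0, le_refl ‖w.bs 0‖⟩
    refine ⟨n, fun m => ?_⟩
    rw [dist_zero_right, dist_zero_right]
    by_contra! h
    exact absurd (hmin (show ‖w.bs m‖ ≤ ‖w.bs 0‖ from h.le.trans hn) h.le) (not_le.2 h)
  have h := Nat.sInf_mem hne n
  rw [dist_zero_right (w.bs n)] at h
  exact h

/-- A distance above `t` forces the ball of radius `t` to be empty, of probability `exp (-π λ t²)`.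
The layer-cake formula then gives `2α ∫ t ^ (2α - 1) exp (-π λ t²) dt`, a Gamma integral. -/
theorem lintegral_userDist_rpow_le {W : Ω → Realization} [IsProbabilityMeasure P]
    (hX : IsPoissonPointProcess P lam fun ω => (W ω).bs) (hW : Measurable fun ω => (W ω).userDist 0)
    (hlam : 0 < lam) {α : ℝ} (hα : 0 < α) :
    ∫⁻ ω, ENNReal.ofReal ((W ω).userDist 0 ^ (2 * α)) ∂P ≤
      ENNReal.ofReal (Real.Gamma (α + 1) / (Real.pi * lam) ^ α) := by
  have hgood : ∀ᵐ ω ∂P, ∀ n, (W ω).userDist 0 ≤ ‖(W ω).bs n‖ := by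
    have hfin : ∀ᵐ ω ∂P, ∀ k, pointCount (W ω).bs (annulus k) ≠ ⊤ :=
      ae_all_iff.2 fun k => hX.ae_pointCount_ne_top (measurableSet_annulus k)
        (by rw [volume_annulus]; exact ENNReal.ofReal_ne_top)
    filter_upwards [hfin] with ω hω n using (W ω).userDist_zero_le hω n
  have htail : ∀ t ∈ Set.Ioi (0 : ℝ), P {ω | t < (W ω).userDist 0} *
      ENNReal.ofReal (t ^ (2 * α - 1)) ≤
      ENNReal.ofReal (t ^ (2 * α - 1) * Real.exp (-(Real.pi * lam) * t ^ (2 : ℝ))) := by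
    intro t ht
    have ht0 : 0 < t := ht
    have h1 : P {ω | t < (W ω).userDist 0} ≤
        P {ω | pointCount (W ω).bs (Metric.ball 0 t) = 0} := by
      refine measure_mono_ae ?_
      filter_upwards [hgood] with ω hω hlt
      refine Set.encard_eq_zero.2 (Set.eq_empty_of_forall_notMem fun n hn => ?_)
      have h2 : ‖(W ω).bs n‖ < t := mem_ball_zero_iff.1 hn
      have h3 : t < (W ω).userDist 0 := hlt
      linarith [hω n]
    rw [hX.measure_pointCount_eq_zero measurableSet_ball measure_ball_lt_top.ne hlam.le,
      EuclideanSpace.volume_ball_fin_two] at h1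
    rw [mul_comm, ENNReal.ofReal_mul (by positivity)]
    gcongr
    refine h1.trans (le_of_eq ?_)
    rw [ENNReal.toReal_mul, ENNReal.toReal_pow, ENNReal.toReal_ofReal ht0.le,
      ENNReal.toReal_ofReal Real.pi_pos.le, Real.rpow_two]
    congr 2
    ring
  have hnn : 0 ≤ᵐ[P] fun ω => (W ω).userDist 0 :=
    Filter.Eventually.of_forall fun ω => dist_nonneg
  rw [lintegral_rpow_eq_lintegral_meas_lt_mul P hnn hW.aemeasurable (by positivity)]
  have hb : 0 < Real.pi * lam := by positivity
  refine (mul_le_mul_right (setLIntegral_mono' measurableSet_Ioi htail) _).trans ?_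
  rw [← ofReal_integral_eq_lintegral_ofReal
    (integrableOn_rpow_mul_exp_neg_mul_rpow (by linarith) two_pos hb)
    ((ae_restrict_mem measurableSet_Ioi).mono fun t ht =>
      mul_nonneg (Real.rpow_nonneg (le_of_lt ht) _) (Real.exp_pos _).le),
    integral_rpow_mul_exp_neg_mul_rpow two_pos (by linarith) hb,
    ← ENNReal.ofReal_mul (by positivity)]
  apply ENNReal.ofReal_le_ofReal
  have e1 : -(2 * α - 1 + 1) / 2 = -α := by ring
  have e2 : (2 * α - 1 + 1) / 2 = α := by ring
  rw [e1, e2, Real.Gamma_add_one hα.ne', Real.rpow_neg hb.le]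
  apply le_of_eq
  field_simp

end Poisson
-- Averaging over the geometry, and the capacity bound.
variable {Ω : Type*} [MeasurableSpace Ω] {P : Measure Ω} [IsProbabilityMeasure P]
  {lam mu : ℝ} {W : Ω → Realization}

omit [IsProbabilityMeasure P] in
theorem IsCellularNetwork.measurableFamily (hW : IsCellularNetwork P lam mu W) :
    Realization.MeasurableFamily W where
  bs := hW.bs_poisson.measurable
  otherUser := hW.user_poisson.measurable
  sched := hW.sched_measurable
  fading := hW.fading_measurable
  coin := hW.coin_measurable

theorem measurable_interferenceFactor (α κ : ℝ) : Measurable (interferenceFactor α κ) := by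
  refine Measurable.iSup fun m => Finset.measurable_fun_prod _ fun n _ => ?_
  exact (Measurable.of_discrete (f := delayFactor α κ)).comp
    (Nat.measurable_floor.comp (measurable_pi_apply n).norm)

/-- Geometry and marks are independent, so Fubini allows the geometry to be frozen while the marks
are averaged. -/
theorem IsCellularNetwork.expectedDelay_le_lintegral (hW : IsCellularNetwork P lam mu W)
    {α β β' γ N M ε : ℝ} (hα : 0 ≤ α) (hβ : 0 ≤ β) (hββ' : β < β') (hγ : 0 < γ)
    (hN : 0 < N) (hM : 0 < M) (hε : 0 < ε) (hε' : ε < 1) :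
    expectedDelay P W α β γ N (powerControl α M (M / (1 - ε))) ≤
      ∫⁻ ω, (ENNReal.ofReal ((1 - ε) * pathLoss α ((W ω).userDist 0)) *
        ENNReal.ofReal (Real.exp (-(β' * N / (M / (1 - ε))))) *
        (interferenceFactor α (β' * γ * (1 - ε)) (W ω).bs)⁻¹)⁻¹ ∂P := by
  set S := powerControl α M (M / (1 - ε)) with hS
  let R : ((ℕ → Plane) × (ℕ → Plane) × (ℕ → ℕ → ℕ)) × ((ℕ → ℕ → ℝ) × (ℕ → ℕ → ℝ)) →
    Realization := fun z => ⟨z.1.1, z.1.2.1, z.1.2.2, z.2.1, z.2.2⟩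
  have hR : Realization.MeasurableFamily R :=
    { bs := measurable_fst.fst
      otherUser := measurable_fst.snd.fst
      sched := measurable_fst.snd.snd
      fading := measurable_snd.fst
      coin := measurable_snd.snd }
  have hF := hR.delay α β γ N (S := S) (measurable_powerControl_prob _ _ _)
    (measurable_powerControl_power _ _ _)
  have hG : Measurable fun ω => ((W ω).bs, (W ω).otherUser, (W ω).sched) :=
    hW.bs_poisson.measurable.prodMk (hW.user_poisson.measurable.prodMk hW.sched_measurable)
  have hY : Measurable fun ω => ((W ω).fading, (W ω).coin) :=
    hW.fading_measurable.prodMk hW.coin_measurable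
  have h1 : expectedDelay P W α β γ N S =
      ∫⁻ ω, ∫⁻ ω', ((((W ω).withMarks (W ω').fading (W ω').coin).delay α β γ N S : ℕ∞) : ℝ≥0∞) ∂P
        ∂P := by
    calc expectedDelay P W α β γ N S
        = ∫⁻ z, (((R z).delay α β γ N S : ℕ∞) : ℝ≥0∞) ∂(P.map fun ω =>
            (((W ω).bs, (W ω).otherUser, (W ω).sched), ((W ω).fading, (W ω).coin))) :=
          (lintegral_map hF (hG.prodMk hY)).symm
      _ = _ := by
          rw [(indepFun_iff_map_prod_eq_prod_map_map hG.aemeasurable hY.aemeasurable).1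
            hW.geometry_indep_marks, lintegral_prod _ hF.aemeasurable,
            lintegral_map hF.lintegral_prod_right' hG]
          refine lintegral_congr fun ω => ?_
          exact lintegral_map (hF.comp measurable_prodMk_left) hY
  rw [h1]
  refine lintegral_mono_ae ?_
  filter_upwards [hW.roundRobin] with ω hω
  exact (W ω).lintegral_delay_withMarks_le hω
    (fun n s => measurable_pi_iff.1 (measurable_pi_iff.1 hW.fading_measurable n) s)
    (fun n s => measurable_pi_iff.1 (measurable_pi_iff.1 hW.coin_measurable n) s)
    hW.fading_law hW.coin_law hW.fading_indep_coin hW.marks_indep hα hβ hββ' hγ hN hM hε hε'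

theorem IsCellularNetwork.expectedDelay_le (hW : IsCellularNetwork P lam mu W) (hlam : 0 < lam)
    {α β β' γ N M ε c : ℝ} (hα : 0 < α) (hβ : 0 ≤ β) (hββ' : β < β') (hγ : 0 < γ)
    (hN : 0 < N) (hM : 0 < M) (hε : 0 < ε) (hε' : ε < 1) (hκ : β' * γ * (1 - ε) < 1)
    (hc : ∀ K : ℕ, ∑ k ∈ Finset.range K,
      Real.pi * (2 * k + 1) * (((1 - β' * γ * (1 - ε) * pathLoss α k)⁻¹) ^ 2 - 1) ≤ c) :
    expectedDelay P W α β γ N (powerControl α M (M / (1 - ε))) ≤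
      ENNReal.ofReal (Real.sqrt ((((1 - ε) * Real.exp (-(β' * N / (M / (1 - ε)))))⁻¹) ^ 2 *
        (1 + Real.Gamma (α + 1) / (Real.pi * lam) ^ α) * Real.exp (c * lam))) := by
  have hε1 : 0 < 1 - ε := by linarith
  have hβ' : 0 < β' := by linarith
  have hκ0 : 0 ≤ β' * γ * (1 - ε) := by positivity
  set A := ((1 - ε) * Real.exp (-(β' * N / (M / (1 - ε)))))⁻¹ with hA
  have hA0 : 0 ≤ A := by positivity
  have hdm := hW.measurableFamily.userDist 0
  let f : Ω → ℝ≥0∞ := fun ω => ENNReal.ofReal (pathLoss α ((W ω).userDist 0))⁻¹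
  let g : Ω → ℝ≥0∞ := fun ω => interferenceFactor α (β' * γ * (1 - ε)) (W ω).bs
  have hfm : Measurable f := ((measurable_pathLoss α).comp hdm).inv.ennreal_ofReal
  have hgm : Measurable g := (measurable_interferenceFactor _ _).comp hW.bs_poisson.measurable
  have hΓ : 0 ≤ Real.Gamma (α + 1) / (Real.pi * lam) ^ α :=
    div_nonneg (Real.Gamma_pos_of_pos (by linarith)).le (by positivity)
  have hinv : ∀ ω, (ENNReal.ofReal ((1 - ε) * pathLoss α ((W ω).userDist 0)) *
        ENNReal.ofReal (Real.exp (-(β' * N / (M / (1 - ε))))) *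
        (interferenceFactor α (β' * γ * (1 - ε)) (W ω).bs)⁻¹)⁻¹ =
      ENNReal.ofReal A * (f * g) ω := by
    intro ω
    have hl := pathLoss_pos α ((W ω).userDist 0)
    rw [← ENNReal.ofReal_mul (by positivity), ENNReal.mul_inv (Or.inl (by
      simpa using by positivity)) (Or.inl ENNReal.ofReal_ne_top), inv_inv,
      ← ENNReal.ofReal_inv_of_pos (by positivity)]
    change _ = _ * (ENNReal.ofReal (pathLoss α ((W ω).userDist 0))⁻¹ * _)
    rw [← mul_assoc, ← ENNReal.ofReal_mul hA0]
    congr 2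
    rw [hA, ← mul_inv]
    congr 1
    ring
  have hf2 : ∫⁻ ω, f ω ^ (2 : ℝ) ∂P ≤
      ENNReal.ofReal (1 + Real.Gamma (α + 1) / (Real.pi * lam) ^ α) := by
    -- This is `max 1 d ^ (2α) ≤ 1 + d ^ (2α)`.
    have hle : ∀ ω, f ω ^ (2 : ℝ) ≤ 1 + ENNReal.ofReal ((W ω).userDist 0 ^ (2 * α)) := by
      intro ω
      have hd0 : 0 ≤ (W ω).userDist 0 := dist_nonneg
      have h1 : ((pathLoss α ((W ω).userDist 0))⁻¹) ^ (2 : ℝ) =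
          (max 1 ((W ω).userDist 0)) ^ (2 * α) := by
        rw [pathLoss, ← Real.rpow_neg (by positivity), neg_neg, ← Real.rpow_mul (by positivity),
          mul_comm]
      simp only [f]
      rw [ENNReal.ofReal_rpow_of_nonneg (inv_nonneg.2 (pathLoss_pos _ _).le) two_pos.le, h1,
        ← ENNReal.ofReal_one, ← ENNReal.ofReal_add zero_le_one (by positivity)]
      apply ENNReal.ofReal_le_ofReal
      rcases le_total 1 ((W ω).userDist 0) with h | h
      · rw [max_eq_right h]; linarith
      · rw [max_eq_left h, Real.one_rpow]
        have : 0 ≤ (W ω).userDist 0 ^ (2 * α) := by positivity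
        linarith
    refine (lintegral_mono hle).trans ?_
    rw [lintegral_add_left measurable_const, lintegral_const, measure_univ, mul_one,
      ENNReal.ofReal_add zero_le_one hΓ, ENNReal.ofReal_one]
    gcongr
    exact lintegral_userDist_rpow_le hW.bs_poisson hdm hlam hα
  have hg2 : ∫⁻ ω, g ω ^ (2 : ℝ) ∂P ≤ ENNReal.ofReal (Real.exp (c * lam)) := by
    simp_rw [ENNReal.rpow_two]
    exact lintegral_interferenceFactor_sq_le hW.bs_poisson hlam.le hα.le hκ0 hκ hc
  refine (hW.expectedDelay_le_lintegral hα.le hβ hββ' hγ hN hM hε hε').trans ?_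
  simp_rw [hinv]
  rw [lintegral_const_mul _ (hfm.mul hgm)]
  calc ENNReal.ofReal A * ∫⁻ ω, (f * g) ω ∂P
      ≤ ENNReal.ofReal A * ((∫⁻ ω, f ω ^ (2 : ℝ) ∂P) ^ (1 / (2 : ℝ)) *
          (∫⁻ ω, g ω ^ (2 : ℝ) ∂P) ^ (1 / (2 : ℝ))) := by
        gcongr
        exact ENNReal.lintegral_mul_le_Lp_mul_Lq P Real.HolderConjugate.two_two
          hfm.aemeasurable hgm.aemeasurable
    _ ≤ ENNReal.ofReal A *
          (ENNReal.ofReal (1 + Real.Gamma (α + 1) / (Real.pi * lam) ^ α) ^ (1 / (2 : ℝ)) *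
          ENNReal.ofReal (Real.exp (c * lam)) ^ (1 / (2 : ℝ))) := by
        gcongr
    _ = _ := by
        rw [ENNReal.ofReal_rpow_of_nonneg (by positivity) (by norm_num),
          ENNReal.ofReal_rpow_of_nonneg (by positivity) (by norm_num), ← Real.sqrt_eq_rpow,
          ← Real.sqrt_eq_rpow, ← ENNReal.ofReal_mul (Real.sqrt_nonneg _),
          ← ENNReal.ofReal_mul hA0, Real.sqrt_mul (by positivity), Real.sqrt_mul (by positivity),
          Real.sqrt_sq hA0, mul_assoc]

/-- For `λ ≥ 1`, drop `λ ^ a ≥ 1` from the denominator inside the root and use `√(exp x) ≤ exp x`.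
For `λ ≤ 1`, moving `λ ^ (a / 2)` under the root leaves an expression at most its value at `λ = 1`.
-/
theorem min_le_div_sqrt {lam a G c₄ c₅ : ℝ} (hlam : 0 < lam) (ha : 0 < a) (hG : 0 ≤ G)
    (hc₄ : 0 ≤ c₄) (hc₅ : 0 < c₅) :
    min (lam ^ (a / 2 + 1) / Real.sqrt (c₅ * (1 + G / Real.pi ^ a) * Real.exp c₄))
      ((Real.sqrt (c₅ * (1 + G / Real.pi ^ a)))⁻¹ * lam * Real.exp (-c₄ * lam)) ≤
      lam / Real.sqrt (c₅ * (1 + G / (Real.pi * lam) ^ a) * Real.exp (c₄ * lam)) := by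
  have hπ := Real.pi_pos
  have hK : 0 < 1 + G / Real.pi ^ a := by positivity
  have hS : 0 < Real.sqrt (c₅ * (1 + G / (Real.pi * lam) ^ a) * Real.exp (c₄ * lam)) := by
    positivity
  rw [Real.mul_rpow hπ.le hlam.le] at hS ⊢
  rcases le_total 1 lam with h | h
  · refine (min_le_right _ _).trans ?_
    have hl : 1 ≤ lam ^ a := Real.one_le_rpow h ha.le
    have hle : Real.sqrt (c₅ * (1 + G / (Real.pi ^ a * lam ^ a)) * Real.exp (c₄ * lam)) ≤
        Real.sqrt (c₅ * (1 + G / Real.pi ^ a)) * Real.exp (c₄ * lam) := by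
      rw [Real.sqrt_mul (by positivity)]
      refine mul_le_mul (Real.sqrt_le_sqrt ?_) ?_ (Real.sqrt_nonneg _) (Real.sqrt_nonneg _)
      · gcongr
        exact le_mul_of_one_le_right (by positivity) hl
      · refine Real.sqrt_le_iff.2 ⟨(Real.exp_pos _).le, ?_⟩
        have : 1 ≤ Real.exp (c₄ * lam) := Real.one_le_exp (by positivity)
        nlinarith
    have heq : (Real.sqrt (c₅ * (1 + G / Real.pi ^ a)))⁻¹ * lam * Real.exp (-c₄ * lam) =
        lam / (Real.sqrt (c₅ * (1 + G / Real.pi ^ a)) * Real.exp (c₄ * lam)) := by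
      rw [neg_mul, Real.exp_neg]
      field_simp
    rw [heq]
    exact div_le_div_of_nonneg_left hlam.le hS hle
  · refine (min_le_left _ _).trans ?_
    have hl0 : 0 < lam ^ a := Real.rpow_pos_of_pos hlam a
    have hl : lam ^ a ≤ 1 := Real.rpow_le_one hlam.le h ha.le
    have hhalf : lam ^ (a / 2) = Real.sqrt (lam ^ a) := by
      rw [Real.sqrt_eq_rpow, ← Real.rpow_mul hlam.le]
      congr 1
      ring
    rw [Real.rpow_add hlam, Real.rpow_one, hhalf, div_le_div_iff₀ (by positivity) hS]
    have hle : Real.sqrt (lam ^ a) *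
        Real.sqrt (c₅ * (1 + G / (Real.pi ^ a * lam ^ a)) * Real.exp (c₄ * lam)) ≤
        Real.sqrt (c₅ * (1 + G / Real.pi ^ a) * Real.exp c₄) := by
      rw [← Real.sqrt_mul hl0.le]
      apply Real.sqrt_le_sqrt
      have e1 : lam ^ a * (c₅ * (1 + G / (Real.pi ^ a * lam ^ a)) * Real.exp (c₄ * lam)) =
          c₅ * (lam ^ a + G / Real.pi ^ a) * Real.exp (c₄ * lam) := by
        field_simp
      rw [e1]
      gcongr
      exact mul_le_of_le_one_right hc₄ h
    calc _ = lam * (Real.sqrt (lam ^ a) *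
          Real.sqrt (c₅ * (1 + G / (Real.pi ^ a * lam ^ a)) * Real.exp (c₄ * lam))) := by ring
      _ ≤ _ := mul_le_mul_of_nonneg_left hle hlam.le

end Cellular
end

theorem theorem3 (α β γ N M ε : ℝ) (hα : 2 < α) (hβ : 0 < β) (hγ : 0 < γ) (hγ' : γ ≤ 1)
    (hN : 0 < N) (hM : 0 < M) (hε : 0 < ε) (hε' : ε < 1) (hκ : β * γ * (1 - ε) < 1) :
    ∃ c₄ c₅ c₆ c₇ : ℝ, 0 < c₄ ∧ 0 < c₅ ∧ 0 < c₆ ∧ 0 < c₇ ∧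
      ∀ (lam mu : ℝ), 0 < lam → 0 < mu →
      ∀ (Ω : Type*) [MeasurableSpace Ω] (P : Measure Ω) [IsProbabilityMeasure P]
        (W : Ω → Cellular.Realization), Cellular.IsCellularNetwork P lam mu W →
        Cellular.expectedDelay P W α β γ N (Cellular.powerControl α M (M / (1 - ε))) ≤
            ENNReal.ofReal (Real.sqrt (c₅ *
              (1 + Real.Gamma (α + 1) / (Real.pi * lam) ^ α) * Real.exp (c₄ * lam))) ∧
        ENNReal.ofReal (min (lam ^ (α / 2 + 1) / c₆) (c₇ * lam * Real.exp (-c₄ * lam))) ≤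
          Cellular.capacity P W lam α β γ N (Cellular.powerControl α M (M / (1 - ε))) := by
  have hε1 : 0 < 1 - ε := by linarith
  -- The room in `β γ (1 - ε) < 1` allows a larger threshold `β'` that still satisfies it.
  obtain ⟨β', hββ', hβ'⟩ : ∃ β', β < β' ∧ β' < 1 / (γ * (1 - ε)) :=
    exists_between <| (lt_div_iff₀ (by positivity)).2 (by rwa [← mul_assoc])
  have hβ'0 : 0 < β' := hβ.trans hββ'
  have hκ' : β' * γ * (1 - ε) < 1 := by
    rw [mul_assoc]
    exact (lt_div_iff₀ (by positivity)).1 hβ'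
  obtain ⟨c, hc0, hc⟩ := Cellular.exists_sum_annulus_le hα (κ := β' * γ * (1 - ε))
    (by positivity) hκ'
  set A := ((1 - ε) * Real.exp (-(β' * N / (M / (1 - ε)))))⁻¹ with hA
  have hA0 : 0 < A := by positivity
  have hΓ : 0 < Real.Gamma (α + 1) := Real.Gamma_pos_of_pos (by linarith)
  have hπ := Real.pi_pos
  have hK : 0 < 1 + Real.Gamma (α + 1) / Real.pi ^ α := by positivity
  -- `A` is the constant in the conditional mean delay, squared to enter the root. `c₆` is the delay
  -- bound at `λ = 1`; `c₇` is the inverse of that bound without its exponential.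
  refine ⟨c, A ^ 2, Real.sqrt (A ^ 2 * (1 + Real.Gamma (α + 1) / Real.pi ^ α) * Real.exp c),
    (Real.sqrt (A ^ 2 * (1 + Real.Gamma (α + 1) / Real.pi ^ α)))⁻¹, hc0, by positivity,
    by positivity, by positivity, ?_⟩
  intro lam mu hlam _ Ω _ P _ W hW
  have hD := hW.expectedDelay_le hlam (by linarith : 0 < α) hβ.le hββ' hγ hN hM hε hε' hκ' hc
  refine ⟨hD, ?_⟩
  rw [Cellular.capacity]
  have hS : 0 < Real.sqrt (A ^ 2 * (1 + Real.Gamma (α + 1) / (Real.pi * lam) ^ α) *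
      Real.exp (c * lam)) := by
    positivity
  refine le_trans ?_ (ENNReal.div_le_div_left hD _)
  rw [← ENNReal.ofReal_div_of_pos hS]
  exact ENNReal.ofReal_le_ofReal
    (Cellular.min_le_div_sqrt hlam (by linarith) hΓ.le hc0.le (by positivity))
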